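/- **Theorem 5.1 (Stability).** Let $I=(-1,1)$, $\alpha\in(1,2)$, $\theta\in[0,1]$, and let $$\mathcal L^\alpha_\theta u=-\bigl[\theta\,{}_{-1}D_x^\alpha u+(1-\theta)\,{}_xD_1^\alpha u\bigr],$$ $${}_{-1}D_x^{\alpha}u(x)=\frac{1}{\Gamma(2-\alpha)}\frac{d^2}{dx^2}\int_{-1}^x\frac{u(\xi)}{(x-\xi)^{\alpha-1}}\,d\xi,\qquad {}_xD_1^{\alpha}u(x)=\frac{1}{\Gamma(2-\alpha)}\frac{d^2}{dx^2}\int_x^1\frac{u(\xi)}{(\xi-x)^{\alpha-1}}\,d\xi .$$ Let $\sigma,\sigma^*\in(0,1]$ be determined by $\sigma+\sigma^*=\alpha$ and $\theta=\dfrac{\sin(\pi\sigma^*)}{\sin(\pi\sigma^*)+\sin(\pi\sigma)}$, and put $$\lambda^\alpha_{\theta,0}=-\frac{\sin(\pi\alpha)}{\sin(\pi\sigma)+\sin(\pi\sigma^*)}\,\Gamma(\alpha+1).$$ Write $\omega^{\gamma,\beta}(x)=(1-x)^\gamma(1+x)^\beta$, $\|g\|_{\omega^{\gamma,\beta}}=\bigl(\int_I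 g^2\,\omega^{\gamma,\beta}\,dx\bigr)^{1/2}$, $(g,v)=\int_I g\,v\,dx$, and let $\mathbb P_N$ be the real polynomials of degree at most $N$, $U_N=\omega^{\sigma,\sigma^*}\mathbb P_N$, $V_N=\omega^{\sigma^*,\sigma}\mathbb P_N$ (functions on $I$). There is a constant $C$, depending only on $\alpha$ and $\theta$, such that for every real $\mu$ with $|\mu|\le\lambda^\alpha_{\theta,0}/2$, every integer $N\ge 0$ and every real function $f$ on $I$ with $f\in L^2_{\omega^{\sigma^*,\sigma}}(I)$, the spectral Petrov–Galerkin scheme: find $u_N\in U_N$ with $$(\mathcal L^\alpha_\theta u_N,v_N)+\mu\,(u_N,v_N)=(f,v_N)\qquad\text{for all } v_N\in V_N,$$ has a unique solution $u_N$. For it the second derivatives in the definition of $\mathcal L^\alpha_\theta u_N$ exist in the classical sense at every point of $I$, $\mathcal L^\alpha_\theta u_N\in L^2_{\omega^{\sigma^*,\sigma}}(I)$, and $$\|\mathcal L^\alpha_\theta u_N\|_{\omega^{\sigma^*,\sigma}}\le C\,\|f\|_{\omega^{\sigma^*,\sigma}} .$$ -/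

import Mathlib

open MeasureTheory Set
open scoped NNReal ENNReal

noncomputable section

namespace FracPG

/-- The Jacobi weight `ω^{γ,β}(x) = (1 - x)^γ (1 + x)^β`, used on `I = (-1, 1)`. -/
def jacobiWeight (γ β x : ℝ) : ℝ := (1 - x) ^ γ * (1 + x) ^ β

/-- The measure `ω^{γ,β}(x) dx` on `I = (-1, 1)`. The norm `‖g‖_{ω^{γ,β}}` is
`eLpNorm g 2 (weightedMeasure γ β)`, with values in `[0, ∞]`. -/
def weightedMeasure (γ β : ℝ) : Measure ℝ :=
  (volume.restrict (Ioo (-1) 1)).withDensity fun x => ENNReal.ofReal (jacobiWeight γ β x)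

/-- The unweighted `L²(I)` pairing `(g, v) = ∫_I g v dx`. -/
def pairing (g v : ℝ → ℝ) : ℝ := ∫ x in Ioo (-1 : ℝ) 1, g x * v x

/-- The left-sided fractional integral of order `2 - α`:
`(1 / Γ(2 - α)) ∫_{-1}^x u(ξ) / (x - ξ)^{α - 1} dξ`. -/
def leftInt (α : ℝ) (u : ℝ → ℝ) (x : ℝ) : ℝ :=
  1 / Real.Gamma (2 - α) * ∫ ξ in (-1 : ℝ)..x, u ξ / (x - ξ) ^ (α - 1)

/-- The right-sided fractional integral of order `2 - α`:
`(1 / Γ(2 - α)) ∫_x^1 u(ξ) / (ξ - x)^{α - 1} dξ`. -/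
def rightInt (α : ℝ) (u : ℝ → ℝ) (x : ℝ) : ℝ :=
  1 / Real.Gamma (2 - α) * ∫ ξ in x..(1 : ℝ), u ξ / (ξ - x) ^ (α - 1)

/-- The left-sided Riemann-Liouville derivative of order `α ∈ (1, 2)` on `(-1, 1)`. -/
def leftRL (α : ℝ) (u : ℝ → ℝ) (x : ℝ) : ℝ := deriv (deriv (leftInt α u)) x

/-- The right-sided Riemann-Liouville derivative of order `α ∈ (1, 2)` on `(-1, 1)`. -/
def rightRL (α : ℝ) (u : ℝ → ℝ) (x : ℝ) : ℝ := deriv (deriv (rightInt α u)) x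

/-- `F` is twice differentiable at every point of `(-1, 1)`. -/
def TwiceDiffOnI (F : ℝ → ℝ) : Prop :=
  ∀ x ∈ Ioo (-1 : ℝ) 1, DifferentiableAt ℝ F x ∧ DifferentiableAt ℝ (deriv F) x

/-- The two-sided operator `L = -[θ (left derivative) + (1 - θ) (right derivative)]`. -/
def fracOp (α θ : ℝ) (u : ℝ → ℝ) (x : ℝ) : ℝ :=
  -(θ * leftRL α u x + (1 - θ) * rightRL α u x)

/-- The exponents: `σ` and `σ* = α - σ` lie in `(0, 1]`, and
`θ = sin(π σ*) / (sin(π σ*) + sin(π σ))`. -/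
def IsExponent (α θ σ : ℝ) : Prop :=
  σ ∈ Ioc (0 : ℝ) 1 ∧ α - σ ∈ Ioc (0 : ℝ) 1 ∧
    θ = Real.sin (Real.pi * (α - σ)) /
      (Real.sin (Real.pi * (α - σ)) + Real.sin (Real.pi * σ))

/-- The pseudo-eigenvalues of the two-sided operator. -/
def pseudoEigenvalue (α σ : ℝ) (n : ℕ) : ℝ :=
  -(Real.sin (Real.pi * α) / (Real.sin (Real.pi * σ) + Real.sin (Real.pi * (α - σ)))) *
    (Real.Gamma (α + n + 1) / (Nat.factorial n : ℝ))

/-- The space `ω^{γ,β} ℙ_N` of weighted polynomials of degree at most `N` on `(-1, 1)`; its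
elements are represented by their extensions by zero, so that equality of functions on the
line is equality on `(-1, 1)`. -/
def weightedPoly (γ β : ℝ) (N : ℕ) : Set (ℝ → ℝ) :=
  {u | ∃ p : Polynomial ℝ, p.natDegree ≤ N ∧
    u = (Ioo (-1 : ℝ) 1).indicator fun x => jacobiWeight γ β x * p.eval x}

/-- `u` solves the spectral Petrov-Galerkin scheme: `u` lies in the trial space
`U_N = ω^{σ,σ*} ℙ_N`, and `(L u, v) + μ (u, v) = (f, v)` for every `v` in the test space
`V_N = ω^{σ*,σ} ℙ_N`. -/
def IsPGSolution (α θ σ μ : ℝ) (N : ℕ) (f u : ℝ → ℝ) : Prop :=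
  u ∈ weightedPoly σ (α - σ) N ∧
    ∀ v ∈ weightedPoly (α - σ) σ N,
      pairing (fracOp α θ u) v + μ * pairing u v = pairing f v

end FracPG

end

namespace FracPG

open Filter Topology Polynomial

/-! Write `a = σ`, `b = σ*`. On trial functions `ω^{a,b} p` the operator acts as a map of
polynomials `p ↦ opPoly a b p` that does not raise degrees and is bounded below. Both facts come
from the two-sided potential `mixedPot`, whose kernel `|x - ξ|^{1-a-b}` carries the weights
`sin(πb)` on the left and `sin(πa)` on the right. The choice of `θ` is exactly what makes the
operator a multiple of its second derivative.

Polynomials. The potential of the bare weight `ω^{a-1,b-1}` is the constant `π` (`mixedPot_one`): a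
projective substitution shows that the one-sided potentials have derivatives proportional to
`ω^{-b,-a}`, the sines make these cancel, and the constant is read off at an endpoint. Since `x M(p)
- M(Xp)` has derivative `(2-a-b) M(p)`, induction on the degree gives polynomial images with
explicit leading coefficients (`exists_polynomial_mixedPot`). Hence `opPoly` is triangular in the
degree, with the pseudo-eigenvalues `λ_n` on the diagonal (`opPoly_degree`), and `λ_0 ≤ λ_n`.

Lower bound. After the reflection `x ↦ -x` the kernel depends on `x + ξ`, so it is symmetric, and
integration by parts makes the reflected operator symmetric in `L²(ω^{a,b})`. A symmetric triangular
operator is diagonal in the orthogonal polynomials, here with eigenvalues `(-1)^n λ_n`. So the image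
of `p` has norm at least `λ_0 ‖p‖_{ω^{a,b}}` (`sq_pseudoEigenvalue_mul_le`), and `‖p‖_{ω^{a,b}}`
dominates the `ω^{b,a}`-norm of `u = ω^{a,b} p`.

Stability. As `Lu` is a polynomial of degree at most `N`, `ω^{b,a} Lu` is an admissible test
function. It gives `‖Lu‖² ≤ ‖f‖ ‖Lu‖ + |μ| ‖u‖ ‖Lu‖`, and `|μ| ‖u‖ ≤ ‖Lu‖ / 2` is absorbed, so `C =
2`. With `f = 0` this is uniqueness; existence follows because trial and test spaces have equal
finite dimension. -/

/-! ### Euler-type integrals -/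

theorem intervalIntegrable_rpow_mul_rpow_mul {p q c d : ℝ} (hpq : p < q) (hc : -1 < c) (hd : -1 < d)
    {g : ℝ → ℝ} (hg : ContinuousOn g (Icc p q)) :
    IntervalIntegrable (fun ξ => (q - ξ) ^ c * (ξ - p) ^ d * g ξ) volume p q := by
  have hm1 : p < (p + q) / 2 := by linarith
  have hm2 : (p + q) / 2 < q := by linarith
  refine IntervalIntegrable.trans (b := (p + q) / 2) ?_ ?_
  · have h1 : IntervalIntegrable (fun ξ : ℝ => (ξ - p) ^ d) volume p ((p + q) / 2) := by
      have := (intervalIntegral.intervalIntegrable_rpow' (a := 0) (b := (p + q) / 2 - p) hd).comp_sub_right p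
      simpa using this
    have h2 : ContinuousOn (fun ξ => (q - ξ) ^ c * g ξ) (uIcc p ((p + q) / 2)) := by
      rw [uIcc_of_le hm1.le]
      refine ContinuousOn.mul (ContinuousOn.rpow_const (by fun_prop) fun x hx => Or.inl ?_)
        (hg.mono (Icc_subset_Icc_right hm2.le))
      have := hx.2; linarith
    refine (h1.continuousOn_mul h2).congr fun x _ => ?_
    ring
  · have h1 : IntervalIntegrable (fun ξ : ℝ => (q - ξ) ^ c) volume ((p + q) / 2) q := by
      have := (intervalIntegral.intervalIntegrable_rpow' (a := q - (p + q) / 2) (b := 0) hc).comp_sub_left q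
      simpa using this
    have h2 : ContinuousOn (fun ξ => (ξ - p) ^ d * g ξ) (uIcc ((p + q) / 2) q) := by
      rw [uIcc_of_le hm2.le]
      refine ContinuousOn.mul (ContinuousOn.rpow_const (by fun_prop) fun x hx => Or.inl ?_)
        (hg.mono (Icc_subset_Icc_left hm1.le))
      have := hx.1; linarith
    refine (h1.continuousOn_mul h2).congr fun x _ => ?_
    ring

/-- The Euler-type integral `∫₀¹ (1 - t)^c t^d φ(t z) dt`. -/
noncomputable def eulerInt (c d : ℝ) (φ : ℝ → ℝ) (z : ℝ) : ℝ :=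
  ∫ t in (0 : ℝ)..1, (1 - t) ^ c * t ^ d * φ (t * z)

theorem intervalIntegrable_eulerInt {c d z : ℝ} (hc : -1 < c) (hd : -1 < d) (hz : z ∈ Ioo (0 : ℝ) 2)
    {φ : ℝ → ℝ} (hφ : ContinuousOn φ (Iio 2)) :
    IntervalIntegrable (fun t => (1 - t) ^ c * t ^ d * φ (t * z)) volume 0 1 := by
  have := intervalIntegrable_rpow_mul_rpow_mul (p := 0) (q := 1) zero_lt_one hc hd
    (g := fun t => φ (t * z)) (hφ.comp (by fun_prop) fun t ht => ?_)
  · simpa using this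
  · have := hz.2; have := ht.2; have := ht.1; have := hz.1
    simp only [mem_Iio]; nlinarith

theorem hasDerivAt_eulerInt {c d z : ℝ} (hc : -1 < c) (hd : -1 < d) (hz : z ∈ Ioo (0 : ℝ) 2)
    {φ φ' : ℝ → ℝ} (hφ : ∀ s < 2, HasDerivAt φ (φ' s) s) (hφ' : ContinuousOn φ' (Iio 2)) :
    HasDerivAt (eulerInt c d φ) (eulerInt c (d + 1) φ' z) z := by
  have hcont : ContinuousOn φ (Iio 2) := fun s hs => (hφ s hs).continuousAt.continuousWithinAt
  -- Staying below `z1 < 2` keeps every `t * y` in the compact `[0, z1]`, away from the possible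
  -- singularity of `φ` at `2`.
  obtain ⟨z1, hz1, hz12⟩ := exists_between hz.2
  have hz10 : 0 < z1 := hz.1.trans hz1
  obtain ⟨M, hM⟩ := (isCompact_Icc (a := (0 : ℝ)) (b := z1)).exists_bound_of_continuousOn
    (hφ'.mono fun s hs => lt_of_le_of_lt hs.2 hz12)
  have key := intervalIntegral.hasDerivAt_integral_of_dominated_loc_of_deriv_le (μ := volume)
    (a := 0) (b := 1) (F := fun z t => (1 - t) ^ c * t ^ d * φ (t * z))
    (F' := fun z t => (1 - t) ^ c * t ^ d * (t * φ' (t * z))) (x₀ := z) (s := Ioo 0 z1)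
    (bound := fun t => (1 - t) ^ c * t ^ d * M) (Ioo_mem_nhds hz.1 hz1) ?_
    (intervalIntegrable_eulerInt hc hd hz hcont) ?_ ?_ ?_ ?_
  · have e : (∫ t in (0 : ℝ)..1, (1 - t) ^ c * t ^ d * (t * φ' (t * z))) = eulerInt c (d + 1) φ' z := by
      unfold eulerInt
      rw [intervalIntegral.integral_of_le zero_le_one, intervalIntegral.integral_of_le zero_le_one]
      refine setIntegral_congr_fun measurableSet_Ioc fun t ht => ?_
      rw [Real.rpow_add_one ht.1.ne']; ring
    rw [← e]
    exact key.2
  · filter_upwards [Ioo_mem_nhds hz.1 hz.2] with y hy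
    exact (intervalIntegrable_iff.1 (intervalIntegrable_eulerInt hc hd hy hcont)).aestronglyMeasurable
  · have := intervalIntegrable_eulerInt hc (d := d + 1) (by linarith) hz hφ'
    refine (intervalIntegrable_iff.1 this).aestronglyMeasurable.congr ?_
    rw [uIoc_of_le zero_le_one]
    filter_upwards [ae_restrict_mem measurableSet_Ioc] with t ht
    rw [Real.rpow_add_one ht.1.ne']; ring
  · refine Eventually.of_forall fun t ht y hy => ?_
    rw [uIoc_of_le zero_le_one] at ht
    have h1 : 0 ≤ (1 - t) ^ c * t ^ d :=
      mul_nonneg (Real.rpow_nonneg (by linarith [ht.2]) _) (Real.rpow_nonneg ht.1.le _)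
    rw [norm_mul, Real.norm_of_nonneg h1]
    refine mul_le_mul_of_nonneg_left ?_ h1
    have h2 := hM (t * y) ⟨by nlinarith [ht.1, hy.1], by nlinarith [ht.2, hy.2, hy.1, ht.1]⟩
    rw [norm_mul, Real.norm_of_nonneg ht.1.le]
    nlinarith [ht.2, ht.1, norm_nonneg (φ' (t * y))]
  · have := intervalIntegrable_rpow_mul_rpow_mul (p := 0) (q := 1) zero_lt_one hc hd
      (g := fun t => M) (by fun_prop)
    simpa using this
  · refine Eventually.of_forall fun t ht y hy => ?_
    rw [uIoc_of_le zero_le_one] at ht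
    have h2 : t * y < 2 := by nlinarith [ht.2, hy.2, hy.1, ht.1]
    have := ((hφ (t * y) h2).comp y ((hasDerivAt_id y).const_mul t)).const_mul ((1 - t) ^ c * t ^ d)
    exact this.congr_deriv (by ring)

theorem eulerInt_add_eulerInt {c d z : ℝ} (hc : -1 < c) (hd : -1 < d) (hz : z ∈ Ioo (0 : ℝ) 2)
    {φ : ℝ → ℝ} (hφ : ContinuousOn φ (Iio 2)) :
    eulerInt (c + 1) d φ z + eulerInt c (d + 1) φ z = eulerInt c d φ z := by
  unfold eulerInt
  rw [← intervalIntegral.integral_add (intervalIntegrable_eulerInt (by linarith) hd hz hφ)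
    (intervalIntegrable_eulerInt hc (by linarith) hz hφ)]
  rw [intervalIntegral.integral_of_le zero_le_one, intervalIntegral.integral_of_le zero_le_one,
    integral_Ioc_eq_integral_Ioo, integral_Ioc_eq_integral_Ioo]
  refine setIntegral_congr_fun measurableSet_Ioo fun t ht => ?_
  rw [Real.rpow_add_one ht.1.ne', Real.rpow_add_one (by linarith [ht.2])]; ring

theorem eulerInt_integration_by_parts {c d z : ℝ} (hc : -1 < c) (hd : -1 < d) (hz : z ∈ Ioo (0 : ℝ) 2)
    {φ φ' : ℝ → ℝ} (hφ : ∀ s < 2, HasDerivAt φ (φ' s) s) (hφ' : ContinuousOn φ' (Iio 2)) :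
    z * eulerInt (c + 1) (d + 1) φ' z =
      (c + 1) * eulerInt c (d + 1) φ z - (d + 1) * eulerInt (c + 1) d φ z := by
  have hcont : ContinuousOn φ (Iio 2) := fun s hs => (hφ s hs).continuousAt.continuousWithinAt
  have i1 := (intervalIntegrable_eulerInt (c := c + 1) (d := d + 1) (by linarith) (by linarith) hz hφ').const_mul z
  have i2 := (intervalIntegrable_eulerInt (c := c) (d := d + 1) hc (by linarith) hz hcont).const_mul (c + 1)
  have i3 := (intervalIntegrable_eulerInt (c := c + 1) (d := d) (by linarith) hd hz hcont).const_mul (d + 1)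
  have key := intervalIntegral.integral_eq_sub_of_hasDerivAt_of_le (zero_le_one (α := ℝ))
    (f := fun t => (1 - t) ^ (c + 1) * t ^ (d + 1) * φ (t * z)) (f' := fun t => z * ((1 - t) ^ (c + 1) * t ^ (d + 1) * φ' (t * z))
      - (c + 1) * ((1 - t) ^ c * t ^ (d + 1) * φ (t * z)) + (d + 1) * ((1 - t) ^ (c + 1) * t ^ d * φ (t * z)))
      ?_ ?_ ((i1.sub i2).add i3)
  · rw [intervalIntegral.integral_add (i1.sub i2) i3, intervalIntegral.integral_sub i1 i2,
      intervalIntegral.integral_const_mul, intervalIntegral.integral_const_mul,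
      intervalIntegral.integral_const_mul] at key
    unfold eulerInt
    rw [Real.zero_rpow (by linarith), sub_self, Real.zero_rpow (by linarith)] at key
    linarith
  · refine ContinuousOn.mul (ContinuousOn.mul ?_ ?_) (hcont.comp (by fun_prop) fun t ht => ?_)
    · exact ContinuousOn.rpow_const (by fun_prop) fun x hx => Or.inr (by linarith)
    · exact ContinuousOn.rpow_const (by fun_prop) fun x hx => Or.inr (by linarith)
    · simp only [mem_Iio]; nlinarith [ht.1, ht.2, hz.1, hz.2]
  · intro t ht
    have h2 : t * z < 2 := by nlinarith [ht.2, hz.2, hz.1, ht.1]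
    have d1 := (hφ (t * z) h2).comp t ((hasDerivAt_id t).mul_const z)
    have d2 : HasDerivAt (fun t : ℝ => (1 - t) ^ (c + 1)) (-((c + 1) * (1 - t) ^ c)) t := by
      have := ((hasDerivAt_id t).const_sub 1).rpow_const (p := c + 1) (Or.inl (by simp; linarith [ht.2]))
      exact this.congr_deriv (by simp only [id, add_sub_cancel_right]; ring)
    have d3 : HasDerivAt (fun t : ℝ => t ^ (d + 1)) ((d + 1) * t ^ d) t := by
      have := (hasDerivAt_id t).rpow_const (p := d + 1) (Or.inl (by simp; linarith [ht.1]))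
      exact this.congr_deriv (by simp only [id, add_sub_cancel_right]; ring)
    refine ((d2.mul d3).mul d1).congr_deriv ?_
    simp only [Function.comp_apply, id, Pi.mul_apply]; ring

theorem integral_one_sub_rpow_mul_rpow {u v : ℝ} (hu : 0 < u) (hv : 0 < v) :
    ∫ t in (0 : ℝ)..1, (1 - t) ^ (v - 1) * t ^ (u - 1) =
      Real.Gamma u * Real.Gamma v / Real.Gamma (u + v) := by
  have h := ProbabilityTheory.beta_eq_betaIntegralReal u v hu hv
  unfold ProbabilityTheory.beta at h
  rw [h]
  have e : Complex.betaIntegral u v = ((∫ t in (0 : ℝ)..1, (1 - t) ^ (v - 1) * t ^ (u - 1) : ℝ) : ℂ) := by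
    unfold Complex.betaIntegral
    rw [← intervalIntegral.integral_ofReal, intervalIntegral.integral_of_le zero_le_one,
      intervalIntegral.integral_of_le zero_le_one]
    refine setIntegral_congr_fun measurableSet_Ioc fun t ht => ?_
    rw [Complex.ofReal_mul, Complex.ofReal_cpow (by linarith [ht.2]), Complex.ofReal_cpow ht.1.le]
    push_cast; ring
  rw [e, Complex.ofReal_re]

/-- The substitution `t = s / (1 - y + s y)` evaluates this integral of projectively invariant
type. -/
theorem integral_projective {a b y : ℝ} (hb : 0 < b) (hab : a + b < 2) (hy : y ∈ Ioo (0 : ℝ) 1) :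
    ∫ t in (0 : ℝ)..1, (1 - t) ^ (1 - a - b) * t ^ (b - 1) * (1 - t * y) ^ (a - 2) =
      (1 - y) ^ (-b) * (Real.Gamma b * Real.Gamma (2 - a - b) / Real.Gamma (2 - a)) := by
  obtain ⟨hy0, hy1⟩ := hy
  have hD : ∀ s ∈ Ioo (0 : ℝ) 1, 0 < 1 - y + s * y := fun s hs => by nlinarith [hs.1]
  have hE : ∀ t ∈ Ioo (0 : ℝ) 1, 0 < 1 - t * y := fun t ht => by nlinarith [ht.1, ht.2]
  have himg : (fun s : ℝ => s / (1 - y + s * y)) '' Ioo 0 1 = Ioo 0 1 := by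
    ext t
    constructor
    · rintro ⟨s, hs, rfl⟩
      have := hD s hs
      refine ⟨div_pos hs.1 this, (div_lt_one this).2 ?_⟩
      nlinarith [hs.2]
    · intro ht
      have h1 := hE t ht
      have h2 : t * (1 - y) / (1 - t * y) ∈ Ioo (0 : ℝ) 1 := by
        refine ⟨div_pos (mul_pos ht.1 (by linarith)) h1, (div_lt_one h1).2 ?_⟩
        nlinarith [ht.2]
      refine ⟨t * (1 - y) / (1 - t * y), h2, ?_⟩
      have h3 := hD _ h2
      have h4 : 1 - y + t * (1 - y) / (1 - t * y) * y = (1 - y) / (1 - t * y) := by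
        have h5 := h1.ne'
        rw [div_mul_eq_mul_div, eq_div_iff h5, add_mul, div_mul_cancel₀ _ h5]; ring
      simp only [h4]
      have : 1 - y ≠ 0 := by linarith
      field_simp
  have hinj : InjOn (fun s : ℝ => s / (1 - y + s * y)) (Ioo 0 1) := by
    intro s hs t ht h
    have h1 := hD s hs
    have h2 := hD t ht
    simp only at h
    rw [div_eq_div_iff h1.ne' h2.ne'] at h
    have : (s - t) * (1 - y) = 0 := by linarith
    rcases mul_eq_zero.1 this with h | h <;> linarith
  have hder : ∀ s ∈ Ioo (0 : ℝ) 1, HasDerivWithinAt (fun s : ℝ => s / (1 - y + s * y))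
      ((1 - y) / (1 - y + s * y) ^ 2) (Ioo 0 1) s := by
    intro s hs
    have h1 := hD s hs
    have := (hasDerivAt_id s).div (((hasDerivAt_id s).mul_const y).const_add (1 - y)) h1.ne'
    refine (this.congr_deriv ?_).hasDerivWithinAt
    simp only [id]; ring
  have key := integral_image_eq_integral_abs_deriv_smul measurableSet_Ioo hder hinj
    (fun t : ℝ => (1 - t) ^ (1 - a - b) * t ^ (b - 1) * (1 - t * y) ^ (a - 2))
  rw [himg] at key
  have hbeta := integral_one_sub_rpow_mul_rpow (u := b) (v := 2 - a - b) hb (by linarith)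
  rw [show b + (2 - a - b) = 2 - a by ring, intervalIntegral.integral_of_le zero_le_one,
    integral_Ioc_eq_integral_Ioo] at hbeta
  rw [intervalIntegral.integral_of_le zero_le_one, integral_Ioc_eq_integral_Ioo, key, ← hbeta,
    ← integral_const_mul]
  refine setIntegral_congr_fun measurableSet_Ioo fun s hs => ?_
  have h1 := hD s hs
  have hy' : 0 < 1 - y := by linarith
  have hs1 : 0 < 1 - s := by linarith [hs.2]
  have e1 : 1 - s / (1 - y + s * y) = (1 - y) * (1 - s) / (1 - y + s * y) := by
    field_simp; ring
  have e2 : 1 - s / (1 - y + s * y) * y = (1 - y) / (1 - y + s * y) := by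
    field_simp; ring
  simp only [smul_eq_mul]
  rw [e1, e2, abs_of_pos (div_pos hy' (pow_pos h1 2)), Real.div_rpow (by positivity) h1.le,
    Real.mul_rpow hy'.le hs1.le, Real.div_rpow hs.1.le h1.le, Real.div_rpow hy'.le h1.le,
    show (2 : ℝ) - a - b - 1 = 1 - a - b by ring]
  have f1 : (1 - y) ^ (-b) = (1 - y) * (1 - y) ^ (1 - a - b) * (1 - y) ^ (a - 2) := by
    rw [mul_assoc, ← Real.rpow_add hy', ← Real.rpow_one_add' hy'.le] <;> [ring_nf; skip]
    linarith
  -- The exponents of the denominator add up to `-2`, so its powers cancel against the square in the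
  -- Jacobian; this is the projective invariance.
  have f2 : (1 - y + s * y) ^ (1 - a - b) * (1 - y + s * y) ^ (b - 1) * (1 - y + s * y) ^ (a - 2)
      * (1 - y + s * y) ^ 2 = 1 := by
    rw [← Real.rpow_natCast, ← Real.rpow_add h1, ← Real.rpow_add h1, ← Real.rpow_add h1]
    rw [show 1 - a - b + (b - 1) + (a - 2) + ((2 : ℕ) : ℝ) = 0 by push_cast; ring, Real.rpow_zero]
  rw [f1]
  have g1 := (Real.rpow_pos_of_pos h1 (1 - a - b)).ne'
  have g2 := (Real.rpow_pos_of_pos h1 (b - 1)).ne'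
  have g3 := (Real.rpow_pos_of_pos h1 (a - 2)).ne'
  generalize (1 - y + s * y) ^ (1 - a - b) = A at *
  generalize (1 - y + s * y) ^ (b - 1) = B at *
  generalize (1 - y + s * y) ^ (a - 2) = C at *
  generalize 1 - y + s * y = D at *
  calc _ = (1 - y) * (1 - y) ^ (1 - a - b) * (1 - y) ^ (a - 2) * ((1 - s) ^ (1 - a - b) * s ^ (b - 1)) / (A * B * C * D ^ 2) := by
        field_simp
    _ = _ := by rw [f2, div_one]

/-! ### One-sided potentials of weighted polynomials -/

/-- The factor of the integrand of `leftPot` that is regular at `-1`, as a function of the distance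
to `-1`. -/
noncomputable def profile (a : ℝ) (p : ℝ[X]) (s : ℝ) : ℝ := (2 - s) ^ (a - 1) * p.eval (s - 1)

theorem contDiffOn_profile (a : ℝ) (p : ℝ[X]) : ContDiffOn ℝ ⊤ (profile a p) (Iio 2) := by
  unfold profile
  refine ContDiffOn.mul (ContDiffOn.rpow_const_of_ne (by fun_prop) fun s hs => ?_) ?_
  · simp only [mem_Iio] at hs; linarith
  · have : ContDiff ℝ ⊤ fun s : ℝ => p.eval (s - 1) := (p.contDiff_aeval ⊤).comp (by fun_prop : ContDiff ℝ ⊤ fun s : ℝ => s - 1)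
    exact this.contDiffOn

theorem hasDerivAt_of_contDiffOn_Iio {φ : ℝ → ℝ} (h : ContDiffOn ℝ ⊤ φ (Iio 2)) {s : ℝ}
    (hs : s < 2) : HasDerivAt φ (deriv φ s) s :=
  ((h.differentiableOn (by simp)).differentiableAt (Iio_mem_nhds hs)).hasDerivAt

theorem contDiffOn_deriv_Iio {φ : ℝ → ℝ} (h : ContDiffOn ℝ ⊤ φ (Iio 2)) :
    ContDiffOn ℝ ⊤ (deriv φ) (Iio 2) := h.deriv_of_isOpen isOpen_Iio (by simp)

/-- The left potential `∫_{-1}^x (x - ξ)^c ω^{a-1,b-1}(ξ) p(ξ) dξ`. -/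
noncomputable def leftPot (c a b : ℝ) (p : ℝ[X]) (x : ℝ) : ℝ :=
  ∫ ξ in (-1 : ℝ)..x, (x - ξ) ^ c * (jacobiWeight (a - 1) (b - 1) ξ * p.eval ξ)

theorem intervalIntegrable_leftPot {c a b x : ℝ} (hc : -1 < c) (hb : 0 < b)
    (hx : x ∈ Ioo (-1 : ℝ) 1) (p : ℝ[X]) :
    IntervalIntegrable (fun ξ => (x - ξ) ^ c * (jacobiWeight (a - 1) (b - 1) ξ * p.eval ξ))
      volume (-1) x := by
  refine (intervalIntegrable_rpow_mul_rpow_mul (d := b - 1) hx.1 hc (by linarith)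
    (g := fun ξ => (1 - ξ) ^ (a - 1) * p.eval ξ) ?_).congr fun ξ _ => ?_
  · refine ContinuousOn.mul (ContinuousOn.rpow_const (by fun_prop) fun s hs => Or.inl ?_)
      p.continuous.continuousOn
    have := hs.2; have := hx.2; linarith
  · simp only [jacobiWeight]
    rw [sub_neg_eq_add, add_comm ξ 1]; ring

theorem leftPot_add {c a b x : ℝ} (hc : -1 < c) (hb : 0 < b) (hx : x ∈ Ioo (-1 : ℝ) 1)
    (p q : ℝ[X]) : leftPot c a b (p + q) x = leftPot c a b p x + leftPot c a b q x := by
  unfold leftPot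
  rw [← intervalIntegral.integral_add (intervalIntegrable_leftPot hc hb hx p)
    (intervalIntegrable_leftPot hc hb hx q)]
  refine intervalIntegral.integral_congr fun ξ _ => ?_
  simp only [eval_add]; ring

theorem leftPot_C_mul (c a b x r : ℝ) (p : ℝ[X]) :
    leftPot c a b (C r * p) x = r * leftPot c a b p x := by
  unfold leftPot
  rw [← intervalIntegral.integral_const_mul]
  refine intervalIntegral.integral_congr fun ξ _ => ?_
  simp only [eval_mul, eval_C]; ring

theorem leftPot_add_one {c a b x : ℝ} (hc : -1 < c) (hb : 0 < b) (hx : x ∈ Ioo (-1 : ℝ) 1)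
    (p : ℝ[X]) : leftPot (c + 1) a b p x = x * leftPot c a b p x - leftPot c a b (X * p) x := by
  unfold leftPot
  rw [← intervalIntegral.integral_const_mul, ← intervalIntegral.integral_sub
    ((intervalIntegrable_leftPot hc hb hx p).const_mul x) (intervalIntegrable_leftPot hc hb hx _),
    intervalIntegral.integral_of_le hx.1.le, intervalIntegral.integral_of_le hx.1.le,
    integral_Ioc_eq_integral_Ioo, integral_Ioc_eq_integral_Ioo]
  refine setIntegral_congr_fun measurableSet_Ioo fun ξ hξ => ?_
  simp only [eval_mul, eval_X]
  rw [Real.rpow_add_one (by linarith [hξ.2])]; ring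

/-- The substitution `ξ = (1 + x) t - 1` freezes the limits and the kernel singularity. The variable
`x` is left only in a power and in a smooth profile, so derivatives can be taken under the integral
even for `c < 0`. -/
theorem leftPot_eq_eulerInt {c a b x : ℝ} (hx : x ∈ Ioo (-1 : ℝ) 1) (p : ℝ[X]) :
    leftPot c a b p x = (1 + x) ^ (c + b) * eulerInt c (b - 1) (profile a p) (1 + x) := by
  have hz : 0 < 1 + x := by linarith [hx.1]
  have h := intervalIntegral.integral_comp_mul_add (a := 0) (b := 1) (c := 1 + x)
    (fun ξ => (x - ξ) ^ c * (jacobiWeight (a - 1) (b - 1) ξ * p.eval ξ)) hz.ne' (-1)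
  have h2 : leftPot c a b p x = (1 + x) * ∫ t in (0 : ℝ)..1, (x - ((1 + x) * t + -1)) ^ c *
      (jacobiWeight (a - 1) (b - 1) ((1 + x) * t + -1) * p.eval ((1 + x) * t + -1)) := by
    rw [h]
    simp only [mul_zero, zero_add, mul_one, smul_eq_mul]
    rw [show 1 + x + -1 = x by ring, mul_inv_cancel_left₀ hz.ne']; rfl
  rw [h2]
  unfold eulerInt
  rw [← intervalIntegral.integral_const_mul, ← intervalIntegral.integral_const_mul,
    intervalIntegral.integral_of_le zero_le_one, intervalIntegral.integral_of_le zero_le_one,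
    integral_Ioc_eq_integral_Ioo, integral_Ioc_eq_integral_Ioo]
  refine setIntegral_congr_fun measurableSet_Ioo fun t ht => ?_
  have h1t : 0 ≤ 1 - t := by linarith [ht.2]
  simp only [jacobiWeight, profile]
  rw [show x - ((1 + x) * t + -1) = (1 + x) * (1 - t) by ring,
    show 1 + ((1 + x) * t + -1) = (1 + x) * t by ring,
    show 1 - ((1 + x) * t + -1) = 2 - t * (1 + x) by ring,
    show (1 + x) * t + -1 = t * (1 + x) - 1 by ring, Real.mul_rpow hz.le h1t,
    Real.mul_rpow hz.le ht.1.le]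
  have : (1 + x) ^ (c + b) = (1 + x) * (1 + x) ^ c * (1 + x) ^ (b - 1) := by
    rw [show c + b = 1 + c + (b - 1) by ring, Real.rpow_add hz, Real.rpow_add hz, Real.rpow_one]
  rw [this]; ring

theorem one_add_mem_Ioo {x : ℝ} (hx : x ∈ Ioo (-1 : ℝ) 1) : 1 + x ∈ Ioo (0 : ℝ) 2 :=
  ⟨by linarith [hx.1], by linarith [hx.2]⟩

theorem hasDerivAt_one_add_rpow_mul_eulerInt {c d e x : ℝ} (hc : -1 < c) (hd : -1 < d)
    (hx : x ∈ Ioo (-1 : ℝ) 1) {φ : ℝ → ℝ} (hφ : ContDiffOn ℝ ⊤ φ (Iio 2)) :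
    HasDerivAt (fun x => (1 + x) ^ e * eulerInt c d φ (1 + x))
      (e * (1 + x) ^ (e - 1) * eulerInt c d φ (1 + x) +
        (1 + x) ^ e * eulerInt c (d + 1) (deriv φ) (1 + x)) x := by
  have hz := one_add_mem_Ioo hx
  have h1 := hasDerivAt_eulerInt hc hd hz (fun s hs => hasDerivAt_of_contDiffOn_Iio hφ hs)
    (contDiffOn_deriv_Iio hφ).continuousOn
  have h2 : HasDerivAt (fun x : ℝ => 1 + x) 1 x := (hasDerivAt_id x).const_add 1
  have h3 := h2.rpow_const (p := e) (Or.inl hz.1.ne')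
  refine (h3.mul (h1.comp x h2)).congr_deriv ?_
  simp only [Function.comp_apply]; ring

theorem leftPot_eventuallyEq {c a b x : ℝ} (hx : x ∈ Ioo (-1 : ℝ) 1) (p : ℝ[X]) :
    leftPot c a b p =ᶠ[𝓝 x]
      fun x => (1 + x) ^ (c + b) * eulerInt c (b - 1) (profile a p) (1 + x) := by
  filter_upwards [Ioo_mem_nhds hx.1 hx.2] with y hy using leftPot_eq_eulerInt hy p

theorem hasDerivAt_leftPot {c a b x : ℝ} (hc : -1 < c) (hb : 0 < b) (hx : x ∈ Ioo (-1 : ℝ) 1)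
    (p : ℝ[X]) : HasDerivAt (leftPot c a b p)
      ((c + b) * (1 + x) ^ (c + b - 1) * eulerInt c (b - 1) (profile a p) (1 + x) +
        (1 + x) ^ (c + b) * eulerInt c (b - 1 + 1) (deriv (profile a p)) (1 + x)) x :=
  (hasDerivAt_one_add_rpow_mul_eulerInt hc (by linarith) hx
    (contDiffOn_profile a p)).congr_of_eventuallyEq (leftPot_eventuallyEq hx p)

theorem twiceDiffOnI_leftPot {c a b : ℝ} (hc : -1 < c) (hb : 0 < b) (p : ℝ[X]) :
    TwiceDiffOnI (leftPot c a b p) := by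
  intro x hx
  refine ⟨(hasDerivAt_leftPot hc hb hx p).differentiableAt, ?_⟩
  have hφ := contDiffOn_profile a p
  have h1 := (((hasDerivAt_one_add_rpow_mul_eulerInt (e := c + b - 1) hc
    (show -1 < b - 1 by linarith) hx hφ).const_mul (c + b)).add
    (hasDerivAt_one_add_rpow_mul_eulerInt (e := c + b) hc
    (show -1 < b - 1 + 1 by linarith) hx (contDiffOn_deriv_Iio hφ))).differentiableAt
  refine h1.congr_of_eventuallyEq ?_
  filter_upwards [Ioo_mem_nhds hx.1 hx.2] with y hy
  rw [(hasDerivAt_leftPot hc hb hy p).deriv, Pi.add_apply]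
  ring

/-- Formally the kernel is differentiated and vanishes at `ξ = x`. In Euler form the derivative
falls on the profile, and integration by parts in `t` moves it back onto the powers. -/
theorem hasDerivAt_leftPot_add_one {c a b x : ℝ} (hc : -1 < c) (hb : 0 < b)
    (hx : x ∈ Ioo (-1 : ℝ) 1) (p : ℝ[X]) :
    HasDerivAt (leftPot (c + 1) a b p) ((c + 1) * leftPot c a b p x) x := by
  have hz := one_add_mem_Ioo hx
  have hφ := contDiffOn_profile a p
  refine (hasDerivAt_leftPot (by linarith) hb hx p).congr_deriv ?_
  have h1 := eulerInt_integration_by_parts hc (show -1 < b - 1 by linarith) hz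
    (fun s hs => hasDerivAt_of_contDiffOn_Iio hφ hs) (contDiffOn_deriv_Iio hφ).continuousOn
  have h2 := eulerInt_add_eulerInt hc (show -1 < b - 1 by linarith) hz hφ.continuousOn
  rw [leftPot_eq_eulerInt hx, ← h2, show c + 1 + b = c + b + 1 by ring, add_sub_cancel_right,
    Real.rpow_add_one hz.1.ne']
  linear_combination (1 + x) ^ (c + b) * h1

/-- The first order differential expression with `(ω^{a,b} q)' = ω^{a-1,b-1} (jacobiDeriv a b q)`. -/
noncomputable def jacobiDeriv (a b : ℝ) (q : ℝ[X]) : ℝ[X] :=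
  (1 - X ^ 2) * derivative q + (C b * (1 - X) - C a * (1 + X)) * q

theorem hasDerivAt_jacobiWeight_mul {a b x : ℝ} (hx : x ∈ Ioo (-1 : ℝ) 1) (q : ℝ[X]) :
    HasDerivAt (fun x => jacobiWeight a b x * q.eval x)
      (jacobiWeight (a - 1) (b - 1) x * (jacobiDeriv a b q).eval x) x := by
  have h1 : 0 < 1 - x := by linarith [hx.2]
  have h2 : 0 < 1 + x := by linarith [hx.1]
  have d1 : HasDerivAt (fun x : ℝ => (1 - x) ^ a) _ x :=
    ((hasDerivAt_id x).const_sub 1).rpow_const (p := a) (Or.inl h1.ne')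
  have d2 : HasDerivAt (fun x : ℝ => (1 + x) ^ b) _ x :=
    ((hasDerivAt_id x).const_add 1).rpow_const (p := b) (Or.inl h2.ne')
  refine ((d1.mul d2).mul (q.hasDerivAt x)).congr_deriv ?_
  simp only [jacobiDeriv, jacobiWeight, id, Pi.mul_apply, eval_add, eval_mul, eval_sub, eval_one, eval_pow,
    eval_X, eval_C]
  have e1 : (1 - x) ^ a = (1 - x) ^ (a - 1) * (1 - x) := by
    rw [← Real.rpow_add_one h1.ne', sub_add_cancel]
  have e2 : (1 + x) ^ b = (1 + x) ^ (b - 1) * (1 + x) := by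
    rw [← Real.rpow_add_one h2.ne', sub_add_cancel]
  rw [e1, e2]; ring

theorem jacobiWeight_eq_mul {a b x : ℝ} (hx : x ∈ Ioo (-1 : ℝ) 1) :
    jacobiWeight a b x = jacobiWeight (a - 1) (b - 1) x * (1 - x ^ 2) := by
  have h1 : 0 < 1 - x := by linarith [hx.2]
  have h2 : 0 < 1 + x := by linarith [hx.1]
  have e1 : (1 - x) ^ a = (1 - x) ^ (a - 1) * (1 - x) := by
    rw [← Real.rpow_add_one h1.ne', sub_add_cancel]
  have e2 : (1 + x) ^ b = (1 + x) ^ (b - 1) * (1 + x) := by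
    rw [← Real.rpow_add_one h2.ne', sub_add_cancel]
  simp only [jacobiWeight]
  rw [e1, e2]; ring

/-- Integration by parts: `(x - ξ)^{c+1} ω^{a,b} q` vanishes at both ends because `c + 1 > 0` and `b
> 0`. -/
theorem leftPot_jacobiDeriv {c a b x : ℝ} (hc : -1 < c) (hb : 0 < b) (hx : x ∈ Ioo (-1 : ℝ) 1)
    (q : ℝ[X]) :
    leftPot (c + 1) a b (jacobiDeriv a b q) x = (c + 1) * leftPot c a b ((1 - X ^ 2) * q) x := by
  have i1 := intervalIntegrable_leftPot (c := c + 1) (a := a) (b := b) (by linarith) hb hx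
    (jacobiDeriv a b q)
  have i2 := (intervalIntegrable_leftPot (a := a) hc hb hx ((1 - X ^ 2) * q)).const_mul (c + 1)
  have key := intervalIntegral.integral_eq_sub_of_hasDerivAt_of_le hx.1.le
    (f := fun ξ => (x - ξ) ^ (c + 1) * (jacobiWeight a b ξ * q.eval ξ)) ?_ ?_ (i1.sub i2)
  · rw [intervalIntegral.integral_sub i1 i2, intervalIntegral.integral_const_mul] at key
    simp only [jacobiWeight, sub_self, Real.zero_rpow (show c + 1 ≠ 0 by linarith), zero_mul,
      add_neg_cancel, Real.zero_rpow hb.ne', mul_zero] at key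
    exact sub_eq_zero.1 key
  · unfold jacobiWeight
    refine ContinuousOn.mul ?_ (ContinuousOn.mul (ContinuousOn.mul ?_ ?_) q.continuous.continuousOn)
    · exact ContinuousOn.rpow_const (by fun_prop) fun ξ _ => Or.inr (by linarith)
    · refine ContinuousOn.rpow_const (by fun_prop) fun ξ hξ => Or.inl ?_
      linarith [hξ.2, hx.2]
    · exact ContinuousOn.rpow_const (by fun_prop) fun ξ _ => Or.inr hb.le
  · intro ξ hξ
    have hξ' : ξ ∈ Ioo (-1 : ℝ) 1 := ⟨hξ.1, hξ.2.trans hx.2⟩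
    have h1 : 0 < x - ξ := by linarith [hξ.2]
    have d1 : HasDerivAt (fun ξ : ℝ => (x - ξ) ^ (c + 1)) _ ξ :=
      ((hasDerivAt_id ξ).const_sub x).rpow_const (p := c + 1) (Or.inl h1.ne')
    refine (d1.mul (hasDerivAt_jacobiWeight_mul hξ' q)).congr_deriv ?_
    simp only [eval_mul, eval_sub, eval_one, eval_pow, eval_X, add_sub_cancel_right, id,
      jacobiWeight_eq_mul (a := a) (b := b) hξ']
    ring

/-- Since `(1 - ξ²) ω^{a-1,b-1} = ω^{a,b}` vanishes at `-1`, the derivative passes from the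
potential to its density without a boundary term. -/
theorem hasDerivAt_leftPot_one_sub_sq_mul {c a b x : ℝ} (hc : -1 < c) (hb : 0 < b)
    (hx : x ∈ Ioo (-1 : ℝ) 1) (q : ℝ[X]) :
    HasDerivAt (leftPot c a b ((1 - X ^ 2) * q)) (leftPot c a b (jacobiDeriv a b q) x) x := by
  have hc' : c + 1 ≠ 0 := by linarith
  have h := (hasDerivAt_leftPot_add_one (a := a) hc hb hx (jacobiDeriv a b q)).const_mul (c + 1)⁻¹
  rw [inv_mul_cancel_left₀ hc'] at h
  refine h.congr_of_eventuallyEq ?_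
  filter_upwards [Ioo_mem_nhds hx.1 hx.2] with y hy
  rw [leftPot_jacobiDeriv hc hb hy, inv_mul_cancel_left₀ hc']

/-! ### The potential of the bare Jacobi weight -/

theorem hasDerivAt_leftPot_one {a b x : ℝ} (hb : 0 < b) (hab : a + b < 2)
    (hx : x ∈ Ioo (-1 : ℝ) 1) :
    HasDerivAt (leftPot (1 - a - b) a b 1)
      ((1 - a) / Real.Gamma (2 - a) * (Real.Gamma b * Real.Gamma (2 - a - b) * 2 ^ (a + b - 1) *
        jacobiWeight (-b) (-a) x)) x := by
  have hc : -1 < 1 - a - b := by linarith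
  have hd : -1 < b - 1 := by linarith
  have hz := one_add_mem_Ioo hx
  have hx2 : 0 < 1 - x := by linarith [hx.2]
  refine (hasDerivAt_leftPot hc hb hx 1).congr_deriv ?_
  have hder : ∀ s < (2 : ℝ), deriv (profile a 1) s = (1 - a) * (2 - s) ^ (a - 2) := by
    intro s hs
    have h2s : 0 < 2 - s := by linarith
    have : HasDerivAt (fun s : ℝ => (2 - s) ^ (a - 1)) _ s :=
      ((hasDerivAt_id s).const_sub 2).rpow_const (p := a - 1) (Or.inl h2s.ne')
    have e : profile a 1 = fun s : ℝ => (2 - s) ^ (a - 1) := by ext s; simp [profile]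
    rw [e, this.deriv, show a - 1 - 1 = a - 2 by ring]
    simp only [id]; ring
  -- With `z = 1 + x`, the two integrands combine through `(2 - tz) + tz = 2` into a single integral
  -- of projective type.
  have e1 : (1 - a - b + b) * eulerInt (1 - a - b) (b - 1) (profile a 1) (1 + x) +
      (1 + x) * eulerInt (1 - a - b) (b - 1 + 1) (deriv (profile a 1)) (1 + x) =
      2 * (1 - a) * 2 ^ (a - 2) * ∫ t in (0 : ℝ)..1, (1 - t) ^ (1 - a - b) * t ^ (b - 1) *
        (1 - t * ((1 + x) / 2)) ^ (a - 2) := by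
    have hφ := contDiffOn_profile a 1
    unfold eulerInt
    rw [← intervalIntegral.integral_const_mul, ← intervalIntegral.integral_const_mul,
      ← intervalIntegral.integral_const_mul, ← intervalIntegral.integral_add
      ((intervalIntegrable_eulerInt hc hd hz hφ.continuousOn).const_mul _)
      ((intervalIntegrable_eulerInt hc (by linarith) hz
        (contDiffOn_deriv_Iio hφ).continuousOn).const_mul _),
      intervalIntegral.integral_of_le zero_le_one, intervalIntegral.integral_of_le zero_le_one,
      integral_Ioc_eq_integral_Ioo, integral_Ioc_eq_integral_Ioo]
    refine setIntegral_congr_fun measurableSet_Ioo fun t ht => ?_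
    have h3 : 0 < 1 - t * ((1 + x) / 2) := by nlinarith [ht.1, ht.2, hz.1, hz.2]
    have h2 : 2 - t * (1 + x) = 2 * (1 - t * ((1 + x) / 2)) := by ring
    have h4 : t * (1 + x) < 2 := by linarith
    simp only [hder _ h4]
    rw [profile, eval_one, h2, show a - 1 = a - 2 + 1 by ring,
      Real.rpow_add_one (mul_pos two_pos h3).ne', Real.mul_rpow two_pos.le h3.le,
      Real.rpow_add_one ht.1.ne']
    ring
  rw [show 1 - a - b + b = 1 - a by ring] at e1 ⊢
  have hy : (1 + x) / 2 ∈ Ioo (0 : ℝ) 1 := ⟨by linarith [hz.1], by linarith [hz.2]⟩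
  rw [integral_projective hb hab hy, show 1 - (1 + x) / 2 = (1 - x) / 2 by ring,
    Real.div_rpow hx2.le two_pos.le] at e1
  have e2 : (1 + x) ^ (1 - a) = (1 + x) ^ (-a) * (1 + x) := by
    rw [← Real.rpow_add_one hz.1.ne']; ring_nf
  have e3 : (2 : ℝ) * 2 ^ (a - 2) / 2 ^ (-b) = 2 ^ (a + b - 1) := by
    rw [mul_comm, ← Real.rpow_add_one two_ne_zero, ← Real.rpow_sub two_pos]
    ring_nf
  rw [show 1 - a - 1 = -a by ring, e2]
  calc _ = (1 + x) ^ (-a) * ((1 - a) * eulerInt (1 - a - b) (b - 1) (profile a 1) (1 + x) +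
      (1 + x) * eulerInt (1 - a - b) (b - 1 + 1) (deriv (profile a 1)) (1 + x)) := by ring
    _ = _ := by rw [e1, ← e3, jacobiWeight]; ring

/-- The reflection formula, which exposes a factor `sin(πa)` and lets the constants of the two sides
match. At `a = 1` both sides vanish. -/
theorem one_sub_div_Gamma_two_sub {a : ℝ} (ha : a ∈ Ioc (0 : ℝ) 1) :
    (1 - a) / Real.Gamma (2 - a) = Real.Gamma a * Real.sin (Real.pi * a) / Real.pi := by
  rcases ha.2.eq_or_lt with rfl | h
  · simp
  · have h1 : 1 - a ≠ 0 := by linarith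
    have h2 := Real.Gamma_mul_Gamma_one_sub a
    have h3 : Real.Gamma (2 - a) = (1 - a) * Real.Gamma (1 - a) := by
      rw [← Real.Gamma_add_one h1]; ring_nf
    have h4 : Real.Gamma (1 - a) ≠ 0 := (Real.Gamma_pos_of_pos (by linarith)).ne'
    have h5 : Real.sin (Real.pi * a) ≠ 0 := (Real.sin_pos_of_pos_of_lt_pi
      (mul_pos Real.pi_pos ha.1) (by nlinarith [Real.pi_pos])).ne'
    rw [h3, div_eq_div_iff (mul_ne_zero h1 h4) Real.pi_ne_zero]
    rw [eq_div_iff h5] at h2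
    linear_combination -(1 - a) * h2

/-- The right potential `∫_x^1 (ξ - x)^c ω^{a-1,b-1}(ξ) p(ξ) dξ`. -/
noncomputable def rightPot (c a b : ℝ) (p : ℝ[X]) (x : ℝ) : ℝ :=
  ∫ ξ in x..(1 : ℝ), (ξ - x) ^ c * (jacobiWeight (a - 1) (b - 1) ξ * p.eval ξ)

theorem jacobiWeight_neg (a b x : ℝ) : jacobiWeight a b (-x) = jacobiWeight b a x := by
  simp only [jacobiWeight, sub_neg_eq_add, ← sub_eq_add_neg]; ring

theorem rightPot_eq_leftPot (c a b : ℝ) (p : ℝ[X]) (x : ℝ) :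
    rightPot c a b p x = leftPot c b a (p.comp (-X)) (-x) := by
  unfold leftPot rightPot
  have := intervalIntegral.integral_comp_neg (a := -1) (b := -x)
    (fun ξ => (ξ - x) ^ c * (jacobiWeight (a - 1) (b - 1) ξ * p.eval ξ))
  rw [neg_neg, neg_neg] at this
  rw [← this]
  refine intervalIntegral.integral_congr fun ξ _ => ?_
  simp only [jacobiWeight_neg, eval_comp, eval_neg, eval_X]
  ring_nf

theorem neg_mem_Ioo_neg_one_one {x : ℝ} (hx : x ∈ Ioo (-1 : ℝ) 1) : -x ∈ Ioo (-1 : ℝ) 1 :=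
  ⟨by linarith [hx.2], by linarith [hx.1]⟩

/-- At `x = 1` the profile becomes `(2 - 2t)^{a-1}` and merges with the kernel into the Beta
integral `B(b, 1 - b)`, convergent because `b < 1`. Since `a ≤ 1`, the limit integrand dominates all
the others. -/
theorem tendsto_leftPot_one_right {a b : ℝ} (ha : a ∈ Ioc (0 : ℝ) 1) (hb0 : 0 < b) (hb : b < 1) :
    Tendsto (leftPot (1 - a - b) a b 1) (𝓝[<] 1) (𝓝 (Real.pi / Real.sin (Real.pi * b))) := by
  have hbeta := integral_one_sub_rpow_mul_rpow hb0 (show 0 < 1 - b by linarith)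
  rw [add_sub_cancel, Real.Gamma_one, div_one, Real.Gamma_mul_Gamma_one_sub] at hbeta
  have hint : IntervalIntegrable (fun t : ℝ => (1 - t) ^ (1 - b - 1) * t ^ (b - 1)) volume 0 1 := by
    have := intervalIntegrable_rpow_mul_rpow_mul (p := 0) (q := 1) zero_lt_one
      (c := 1 - b - 1) (d := b - 1) (by linarith) (by linarith) (g := fun t => 1) (by fun_prop)
    simpa using this
  have hpw : ∀ t ∈ Ioo (0 : ℝ) 1, (1 - t) ^ (1 - a - b) * t ^ (b - 1) * (2 - t * 2) ^ (a - 1) =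
      2 ^ (a - 1) * ((1 - t) ^ (1 - b - 1) * t ^ (b - 1)) := by
    intro t ht
    have h1 : 0 < 1 - t := by linarith [ht.2]
    rw [show 2 - t * 2 = 2 * (1 - t) by ring, Real.mul_rpow two_pos.le h1.le,
      show 1 - b - 1 = 1 - a - b + (a - 1) by ring, Real.rpow_add h1]
    ring
  have h1 : Tendsto (fun x => eulerInt (1 - a - b) (b - 1) (profile a 1) (1 + x)) (𝓝[<] 1)
      (𝓝 (∫ t in (0 : ℝ)..1, (1 - t) ^ (1 - a - b) * t ^ (b - 1) * (2 - t * 2) ^ (a - 1))) := by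
    refine intervalIntegral.tendsto_integral_filter_of_dominated_convergence
      (fun t => 2 ^ (a - 1) * ((1 - t) ^ (1 - b - 1) * t ^ (b - 1))) ?_ ?_ (hint.const_mul _) ?_
    · filter_upwards [Ioo_mem_nhdsLT (show (-1 : ℝ) < 1 by norm_num)] with x hx
      exact (intervalIntegrable_iff.1 (intervalIntegrable_eulerInt (by linarith [ha.2]) (by linarith)
        (one_add_mem_Ioo hx) (contDiffOn_profile a 1).continuousOn)).aestronglyMeasurable
    · filter_upwards [Ioo_mem_nhdsLT (show (-1 : ℝ) < 1 by norm_num)] with x hx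
      have hne : ∀ᵐ t : ℝ, t ≠ 1 := by simp [ae_iff, measure_singleton]
      filter_upwards [hne] with t ht1 ht
      rw [uIoc_of_le zero_le_one] at ht
      have ht' : t ∈ Ioo (0 : ℝ) 1 := ⟨ht.1, lt_of_le_of_ne ht.2 ht1⟩
      have h1t : 0 < 1 - t := by linarith [ht'.2]
      have h3 : 0 ≤ (1 - t) ^ (1 - a - b) * t ^ (b - 1) :=
        mul_nonneg (Real.rpow_nonneg h1t.le _) (Real.rpow_nonneg ht.1.le _)
      rw [← hpw t ht', profile, eval_one, mul_one]
      have h4 : 2 - t * 2 ≤ 2 - t * (1 + x) := by nlinarith [hx.2, ht.1]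
      rw [Real.norm_of_nonneg (mul_nonneg h3 (Real.rpow_nonneg (by linarith) _))]
      exact mul_le_mul_of_nonneg_left
        (Real.rpow_le_rpow_of_nonpos (by linarith) h4 (by linarith [ha.2])) h3
    · have hne : ∀ᵐ t : ℝ, t ≠ 1 := by simp [ae_iff, measure_singleton]
      filter_upwards [hne] with t ht1 ht
      rw [uIoc_of_le zero_le_one] at ht
      have ht' : t ∈ Ioo (0 : ℝ) 1 := ⟨ht.1, lt_of_le_of_ne ht.2 ht1⟩
      refine tendsto_nhdsWithin_of_tendsto_nhds (Tendsto.const_mul _ ?_)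
      have : ContinuousAt (fun x : ℝ => (2 - t * (1 + x)) ^ (a - 1)) 1 := by
        refine ContinuousAt.rpow_const (by fun_prop) (Or.inl ?_)
        linarith [ht'.2]
      have h := this.tendsto
      simp only [profile, eval_one, mul_one]
      rwa [one_add_one_eq_two] at h
  have e : (∫ t in (0 : ℝ)..1, (1 - t) ^ (1 - a - b) * t ^ (b - 1) * (2 - t * 2) ^ (a - 1)) =
      2 ^ (a - 1) * (Real.pi / Real.sin (Real.pi * b)) := by
    rw [← hbeta, ← intervalIntegral.integral_const_mul, intervalIntegral.integral_of_le zero_le_one,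
      intervalIntegral.integral_of_le zero_le_one, integral_Ioc_eq_integral_Ioo,
      integral_Ioc_eq_integral_Ioo]
    exact setIntegral_congr_fun measurableSet_Ioo hpw
  rw [e] at h1
  have h2 : Tendsto (fun x : ℝ => (1 + x) ^ (1 - a)) (𝓝[<] 1) (𝓝 (2 ^ (1 - a))) := by
    have : ContinuousAt (fun x : ℝ => (1 + x) ^ (1 - a)) 1 :=
      ContinuousAt.rpow_const (by fun_prop) (Or.inl (by norm_num))
    have h := this.tendsto
    rw [one_add_one_eq_two] at h
    exact tendsto_nhdsWithin_of_tendsto_nhds h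
  have h3 := h2.mul h1
  rw [← mul_assoc, ← Real.rpow_add two_pos, show 1 - a + (a - 1) = 0 by ring, Real.rpow_zero,
    one_mul] at h3
  refine h3.congr' ?_
  filter_upwards [Ioo_mem_nhdsLT (show (-1 : ℝ) < 1 by norm_num)] with x hx
  rw [leftPot_eq_eulerInt hx, sub_add_cancel]

theorem tendsto_leftPot_one_left {a b : ℝ} (ha : a < 1) (hb : 0 < b) (hab : a + b < 2) :
    Tendsto (leftPot (1 - a - b) a b 1) (𝓝[>] (-1)) (𝓝 0) := by
  have hint : IntervalIntegrable (fun t : ℝ => (1 - t) ^ (1 - a - b) * t ^ (b - 1)) volume 0 1 := by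
    have := intervalIntegrable_rpow_mul_rpow_mul (p := 0) (q := 1) zero_lt_one
      (c := 1 - a - b) (d := b - 1) (by linarith) (by linarith) (g := fun t => 1) (by fun_prop)
    simpa using this
  have h1 : Tendsto (fun x : ℝ => (1 + x) ^ (1 - a) *
      ∫ t in (0 : ℝ)..1, (1 - t) ^ (1 - a - b) * t ^ (b - 1)) (𝓝[>] (-1)) (𝓝 0) := by
    have : ContinuousAt (fun x : ℝ => (1 + x) ^ (1 - a)) (-1) :=
      ContinuousAt.rpow_const (by fun_prop) (Or.inr (by linarith))
    have h := (this.tendsto.mul_const (∫ t in (0 : ℝ)..1, (1 - t) ^ (1 - a - b) * t ^ (b - 1)))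
    rw [add_neg_cancel, Real.zero_rpow (by linarith), zero_mul] at h
    exact tendsto_nhdsWithin_of_tendsto_nhds h
  refine squeeze_zero_norm' ?_ h1
  filter_upwards [Ioo_mem_nhdsGT (show (-1 : ℝ) < 0 by norm_num)] with x hx
  have hx' : x ∈ Ioo (-1 : ℝ) 1 := ⟨hx.1, by linarith [hx.2]⟩
  have hz : 0 < 1 + x := by linarith [hx.1]
  rw [leftPot_eq_eulerInt hx', sub_add_cancel, norm_mul,
    Real.norm_of_nonneg (Real.rpow_nonneg hz.le _)]
  refine mul_le_mul_of_nonneg_left ?_ (Real.rpow_nonneg hz.le _)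
  refine intervalIntegral.norm_integral_le_of_norm_le zero_le_one ?_ hint
  refine Eventually.of_forall fun t ht => ?_
  have h3 : 0 ≤ (1 - t) ^ (1 - a - b) * t ^ (b - 1) :=
    mul_nonneg (Real.rpow_nonneg (by linarith [ht.2]) _) (Real.rpow_nonneg ht.1.le _)
  have h4 : 1 ≤ 2 - t * (1 + x) := by nlinarith [ht.1, ht.2, hx.2]
  rw [profile, eval_one, mul_one,
    Real.norm_of_nonneg (mul_nonneg h3 (Real.rpow_nonneg (by linarith) _))]
  exact mul_le_of_le_one_right h3 (Real.rpow_le_one_of_one_le_of_nonpos h4 (by linarith))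

/-! ### The two-sided potential preserves polynomials -/

/-- The two-sided potential whose second derivative is, up to a constant, the two-sided fractional
operator. -/
noncomputable def mixedPot (a b : ℝ) (p : ℝ[X]) (x : ℝ) : ℝ :=
  Real.sin (Real.pi * b) * leftPot (1 - a - b) a b p x +
    Real.sin (Real.pi * a) * rightPot (1 - a - b) a b p x

theorem mixedPot_eq (a b : ℝ) (p : ℝ[X]) (x : ℝ) :
    mixedPot a b p x = Real.sin (Real.pi * b) * leftPot (1 - a - b) a b p x +
      Real.sin (Real.pi * a) * leftPot (1 - b - a) b a (p.comp (-X)) (-x) := by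
  rw [mixedPot, rightPot_eq_leftPot, sub_right_comm]

theorem mixedPot_neg (a b : ℝ) (p : ℝ[X]) (x : ℝ) :
    mixedPot a b p (-x) = mixedPot b a (p.comp (-X)) x := by
  rw [mixedPot_eq, mixedPot_eq, neg_neg, comp_assoc]
  simp [add_comm]

/-- Both one-sided derivatives are multiples of `ω^{-b,-a}`. Weighted by the opposite sines, their
constants become `sin(πa) sin(πb) Γ(a) Γ(b)` times common factors, with opposite signs. -/
theorem exists_mixedPot_one_eq {a b : ℝ} (ha : a ∈ Ioc (0 : ℝ) 1) (hb : b ∈ Ioc (0 : ℝ) 1)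
    (hab : a + b < 2) : ∃ k, ∀ x ∈ Ioo (-1 : ℝ) 1, mixedPot a b 1 x = k := by
  have hder : ∀ x ∈ Ioo (-1 : ℝ) 1, HasDerivAt (mixedPot a b 1) 0 x := by
    intro x hx
    have h1 := hasDerivAt_leftPot_one hb.1 hab hx
    have h2 := (hasDerivAt_leftPot_one ha.1 (by linarith) (neg_mem_Ioo_neg_one_one hx)).comp x
      (hasDerivAt_neg x)
    have h3 := (h1.const_mul (Real.sin (Real.pi * b))).add (h2.const_mul (Real.sin (Real.pi * a)))
    have e : mixedPot a b 1 = (fun x => Real.sin (Real.pi * b) * leftPot (1 - a - b) a b 1 x) +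
        fun x => Real.sin (Real.pi * a) * (leftPot (1 - b - a) b a 1 ∘ Neg.neg) x := by
      ext x
      simp [mixedPot_eq]
    rw [e]
    refine h3.congr_deriv ?_
    rw [one_sub_div_Gamma_two_sub ha, one_sub_div_Gamma_two_sub hb, jacobiWeight_neg,
      sub_right_comm 2 b a, add_comm b a]
    ring
  obtain ⟨k, hk⟩ := isOpen_Ioo.exists_is_const_of_deriv_eq_zero isPreconnected_Ioo
    (fun x hx => (hder x hx).differentiableAt.differentiableWithinAt)
    (fun x hx => (hder x hx).deriv)
  exact ⟨k, hk⟩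

/-- The constant is found by letting `x → 1`: the left potential tends to `π / sin(πb)` and the
right one to `0`. -/
theorem mixedPot_one_of_lt {a b : ℝ} (ha : a ∈ Ioc (0 : ℝ) 1) (hb : b ∈ Ioc (0 : ℝ) 1)
    (hb1 : b < 1) {x : ℝ} (hx : x ∈ Ioo (-1 : ℝ) 1) : mixedPot a b 1 x = Real.pi := by
  obtain ⟨k, hk⟩ := exists_mixedPot_one_eq ha hb (by linarith [ha.2])
  rw [hk x hx]
  have h1 := tendsto_leftPot_one_right ha hb.1 hb1
  have hneg : Tendsto (fun x : ℝ => -x) (𝓝[<] 1) (𝓝[>] (-1)) := tendsto_neg_nhdsLT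
  have h2 := (tendsto_leftPot_one_left hb1 ha.1 (by linarith [ha.2])).comp hneg
  have h3 := (h1.const_mul (Real.sin (Real.pi * b))).add (h2.const_mul (Real.sin (Real.pi * a)))
  have h5 : Real.sin (Real.pi * b) ≠ 0 := (Real.sin_pos_of_pos_of_lt_pi
      (mul_pos Real.pi_pos hb.1) (by nlinarith [Real.pi_pos])).ne'
  rw [mul_div_cancel₀ _ h5, mul_zero, add_zero] at h3
  refine tendsto_nhds_unique (tendsto_const_nhds.congr' ?_) h3
  filter_upwards [Ioo_mem_nhdsLT (show (-1 : ℝ) < 1 by norm_num)] with y hy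
  rw [← hk y hy, mixedPot_eq]
  simp

theorem mixedPot_one {a b : ℝ} (ha : a ∈ Ioc (0 : ℝ) 1) (hb : b ∈ Ioc (0 : ℝ) 1)
    (hab : a + b < 2) {x : ℝ} (hx : x ∈ Ioo (-1 : ℝ) 1) : mixedPot a b 1 x = Real.pi := by
  rcases hb.2.eq_or_lt with h | h
  -- If `b = 1` then `a < 1`, and reflection exchanges the two exponents.
  · have := mixedPot_one_of_lt hb ha (by linarith) (neg_mem_Ioo_neg_one_one hx)
    rwa [mixedPot_neg, one_comp] at this
  · exact mixedPot_one_of_lt ha hb h hx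

theorem mixedPot_add {a b x : ℝ} (ha : 0 < a) (hb : 0 < b) (hab : a + b < 2)
    (hx : x ∈ Ioo (-1 : ℝ) 1) (p q : ℝ[X]) :
    mixedPot a b (p + q) x = mixedPot a b p x + mixedPot a b q x := by
  rw [mixedPot_eq, mixedPot_eq, mixedPot_eq, add_comp,
    leftPot_add (by linarith) hb hx, leftPot_add (by linarith) ha (neg_mem_Ioo_neg_one_one hx)]
  ring

theorem mixedPot_C_mul (a b x r : ℝ) (p : ℝ[X]) :
    mixedPot a b (C r * p) x = r * mixedPot a b p x := by
  rw [mixedPot_eq, mixedPot_eq, mul_comp, C_comp, leftPot_C_mul, leftPot_C_mul]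
  ring

/-- The factor `x - ξ` raises the kernel exponent by one, with a minus sign on the right side, and
differentiation lowers it again. This drives the induction on the degree. -/
theorem hasDerivAt_mul_mixedPot_sub {a b x : ℝ} (ha : 0 < a) (hb : 0 < b) (hab : a + b < 2)
    (hx : x ∈ Ioo (-1 : ℝ) 1) (p : ℝ[X]) :
    HasDerivAt (fun x => x * mixedPot a b p x - mixedPot a b (X * p) x)
      ((2 - a - b) * mixedPot a b p x) x := by
  have h1 := hasDerivAt_leftPot_add_one (c := 1 - a - b) (a := a) (by linarith) hb hx p
  have h2 := (hasDerivAt_leftPot_add_one (c := 1 - b - a) (a := b) (by linarith) ha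
    (neg_mem_Ioo_neg_one_one hx) (p.comp (-X))).comp x (hasDerivAt_neg x)
  have h3 := (h1.const_mul (Real.sin (Real.pi * b))).sub (h2.const_mul (Real.sin (Real.pi * a)))
  refine (h3.congr_deriv ?_).congr_of_eventuallyEq ?_
  · rw [mixedPot_eq]; ring
  · filter_upwards [Ioo_mem_nhds hx.1 hx.2] with y hy
    simp only [Pi.sub_apply, Function.comp_apply]
    rw [mixedPot_eq, mixedPot_eq, leftPot_add_one (by linarith) hb hy,
      leftPot_add_one (by linarith) ha (neg_mem_Ioo_neg_one_one hy), mul_comp, X_comp,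
      show -X * p.comp (-X) = C (-1) * (X * p.comp (-X)) by simp, leftPot_C_mul]
    ring

theorem jacobiDeriv_comp_neg (a b : ℝ) (q : ℝ[X]) :
    jacobiDeriv b a (q.comp (-X)) = C (-1) * (jacobiDeriv a b q).comp (-X) := by
  simp [jacobiDeriv, derivative_comp]
  ring

theorem hasDerivAt_mixedPot_one_sub_sq_mul {a b x : ℝ} (ha : 0 < a) (hb : 0 < b) (hab : a + b < 2)
    (hx : x ∈ Ioo (-1 : ℝ) 1) (q : ℝ[X]) :
    HasDerivAt (mixedPot a b ((1 - X ^ 2) * q)) (mixedPot a b (jacobiDeriv a b q) x) x := by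
  have h1 := hasDerivAt_leftPot_one_sub_sq_mul (c := 1 - a - b) (a := a) (by linarith) hb hx q
  have h2 := (hasDerivAt_leftPot_one_sub_sq_mul (c := 1 - b - a) (a := b) (by linarith) ha
    (neg_mem_Ioo_neg_one_one hx) (q.comp (-X))).comp x (hasDerivAt_neg x)
  have h3 := (h1.const_mul (Real.sin (Real.pi * b))).add (h2.const_mul (Real.sin (Real.pi * a)))
  refine (h3.congr_deriv ?_).congr_of_eventuallyEq ?_
  · rw [mixedPot_eq, jacobiDeriv_comp_neg, leftPot_C_mul]; ring
  · refine Eventually.of_forall fun y => ?_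
    rw [mixedPot_eq]
    simp

/-- The factor by which `mixedPot` multiplies leading coefficients of degree `n`. -/
noncomputable def mixedCoeff (a b : ℝ) (n : ℕ) : ℝ :=
  Real.pi * Real.Gamma (n + (a + b - 1)) / (Real.Gamma (a + b - 1) * (n.factorial : ℝ))

theorem mixedCoeff_succ {a b : ℝ} (hab : 1 < a + b) (n : ℕ) :
    mixedCoeff a b (n + 1) = mixedCoeff a b n * (1 - (2 - a - b) / (n + 1)) := by
  have h1 : (n : ℝ) + (a + b - 1) ≠ 0 := by
    have : (0 : ℝ) ≤ n := n.cast_nonneg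
    linarith
  have h2 := (Real.Gamma_pos_of_pos (show 0 < a + b - 1 by linarith)).ne'
  have h3 : (n.factorial : ℝ) ≠ 0 := by exact_mod_cast n.factorial_ne_zero
  have h4 : (n : ℝ) + 1 ≠ 0 := by positivity
  unfold mixedCoeff
  rw [Nat.factorial_succ]
  push_cast
  rw [show (n : ℝ) + 1 + (a + b - 1) = n + (a + b - 1) + 1 by ring, Real.Gamma_add_one h1]
  field_simp
  ring

theorem exists_antiderivative {Q : ℝ[X]} {n : ℕ} (hQ : Q.natDegree ≤ n) :
    ∃ R : ℝ[X], derivative R = Q ∧ R.natDegree ≤ n + 1 ∧ R.coeff (n + 1) = Q.coeff n / (n + 1) := by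
  refine ⟨∑ i ∈ Finset.range (n + 1), monomial (i + 1) (Q.coeff i / (i + 1)), ?_, ?_, ?_⟩
  · rw [derivative_sum]
    conv_rhs => rw [Q.as_sum_range' (n + 1) (by omega)]
    refine Finset.sum_congr rfl fun i _ => ?_
    rw [derivative_monomial, add_tsub_cancel_right]
    push_cast
    rw [div_mul_cancel₀]
    positivity
  · refine natDegree_sum_le_of_forall_le _ _ fun i hi => (natDegree_monomial_le _).trans ?_
    have := Finset.mem_range.1 hi
    omega
  · rw [finsetSum_coeff, Finset.sum_eq_single n]
    · simp
    · intro i _ hi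
      rw [coeff_monomial, if_neg (by omega)]
    · simp

/-- Split `p = X * p.divX + p(0)`. The potential of the second part is `π p(0)`; that of the first
is `x M - (2-a-b) ∫ M` up to a constant, with `M` the potential of `p.divX`. Integration divides the
leading coefficient by `n + 1`, which is the recursion of `mixedCoeff`. -/
theorem exists_polynomial_mixedPot {a b : ℝ} (ha : a ∈ Ioc (0 : ℝ) 1) (hb : b ∈ Ioc (0 : ℝ) 1)
    (hab : a + b ∈ Ioo (1 : ℝ) 2) (n : ℕ) : ∀ p : ℝ[X], p.natDegree ≤ n →
    ∃ P : ℝ[X], P.natDegree ≤ n ∧ P.coeff n = mixedCoeff a b n * p.coeff n ∧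
      ∀ x ∈ Ioo (-1 : ℝ) 1, mixedPot a b p x = P.eval x := by
  induction n with
  | zero =>
    intro p hp
    refine ⟨C (p.coeff 0 * Real.pi), natDegree_C _ |>.le, ?_, fun x hx => ?_⟩
    · have h2 := (Real.Gamma_pos_of_pos (show 0 < a + b - 1 by linarith [hab.1])).ne'
      simp [mixedCoeff]
      field_simp
    · conv_lhs => rw [eq_C_of_natDegree_le_zero hp, ← mul_one (C (p.coeff 0)), mixedPot_C_mul,
        mixedPot_one ha hb hab.2 hx]
      simp
  | succ n ih =>
    intro p hp
    obtain ⟨Q, hQd, hQc, hQ⟩ := ih p.divX (by rw [natDegree_divX_eq_natDegree_tsub_one]; omega)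
    obtain ⟨R, hR, hRd, hRc⟩ := exists_antiderivative hQd
    have hder : ∀ x ∈ Ioo (-1 : ℝ) 1, HasDerivAt (fun x => x * mixedPot a b p.divX x -
        mixedPot a b (X * p.divX) x - (2 - a - b) * R.eval x) 0 x := by
      intro x hx
      refine ((hasDerivAt_mul_mixedPot_sub ha.1 hb.1 hab.2 hx p.divX).sub
        ((R.hasDerivAt x).const_mul (2 - a - b))).congr_deriv ?_
      rw [hR, hQ x hx, sub_self]
    obtain ⟨k, hk⟩ := isOpen_Ioo.exists_is_const_of_deriv_eq_zero isPreconnected_Ioo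
      (fun x hx => (hder x hx).differentiableAt.differentiableWithinAt)
      (fun x hx => (hder x hx).deriv)
    -- `R` is the antiderivative of `Q`, and `k` is the constant of integration.
    refine ⟨X * Q - C (2 - a - b) * R + C (p.coeff 0 * Real.pi - k), ?_, ?_, fun x hx => ?_⟩
    · refine natDegree_add_le_of_degree_le ((natDegree_sub_le _ _).trans (max_le ?_ ?_))
        ((natDegree_C _).le.trans (Nat.zero_le _))
      · exact natDegree_mul_le.trans (by rw [natDegree_X]; omega)
      · exact (natDegree_C_mul_le _ _).trans hRd
    · have hp1 : p.coeff (n + 1) = p.divX.coeff n := by rw [coeff_divX]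
      rw [coeff_add, coeff_sub, coeff_X_mul, coeff_C_mul, coeff_C_succ, hRc, hQc,
        mixedCoeff_succ hab.1, hp1]
      ring
    · conv_lhs => rw [← X_mul_divX_add p, mixedPot_add ha.1 hb.1 hab.2 hx,
        ← mul_one (C (p.coeff 0)), mixedPot_C_mul, mixedPot_one ha hb hab.2 hx]
      have h1 := hk x hx
      simp only [hQ x hx] at h1
      simp only [eval_add, eval_sub, eval_mul, eval_X, eval_C]
      linarith

theorem eq_of_eval_eq_on_Ioo {P Q : ℝ[X]} (h : ∀ x ∈ Ioo (-1 : ℝ) 1, P.eval x = Q.eval x) :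
    P = Q :=
  eq_of_infinite_eval_eq P Q ((Ioo_infinite (by norm_num : (-1 : ℝ) < 1)).mono h)

open Classical in
/-- The polynomial that agrees with `mixedPot a b p` on `(-1, 1)`. -/
noncomputable def mixedPoly (a b : ℝ) (p : ℝ[X]) : ℝ[X] :=
  if h : ∃ P : ℝ[X], ∀ x ∈ Ioo (-1 : ℝ) 1, mixedPot a b p x = P.eval x then h.choose else 0

section

variable {a b : ℝ} (ha : a ∈ Ioc (0 : ℝ) 1) (hb : b ∈ Ioc (0 : ℝ) 1) (hab : a + b ∈ Ioo (1 : ℝ) 2)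

include ha hb hab

theorem eval_mixedPoly (p : ℝ[X]) {x : ℝ} (hx : x ∈ Ioo (-1 : ℝ) 1) :
    (mixedPoly a b p).eval x = mixedPot a b p x := by
  obtain ⟨P, _, _, hP⟩ := exists_polynomial_mixedPot ha hb hab _ p le_rfl
  have h : ∃ P : ℝ[X], ∀ x ∈ Ioo (-1 : ℝ) 1, mixedPot a b p x = P.eval x := ⟨P, hP⟩
  rw [mixedPoly, dif_pos h, ← h.choose_spec x hx]

theorem mixedPoly_add (p q : ℝ[X]) : mixedPoly a b (p + q) = mixedPoly a b p + mixedPoly a b q :=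
  eq_of_eval_eq_on_Ioo fun x hx => by
    rw [eval_add, eval_mixedPoly ha hb hab _ hx, eval_mixedPoly ha hb hab _ hx,
      eval_mixedPoly ha hb hab _ hx, mixedPot_add ha.1 hb.1 hab.2 hx]

theorem mixedPoly_C_mul (r : ℝ) (p : ℝ[X]) :
    mixedPoly a b (C r * p) = C r * mixedPoly a b p :=
  eq_of_eval_eq_on_Ioo fun x hx => by
    rw [eval_mul, eval_C, eval_mixedPoly ha hb hab _ hx, eval_mixedPoly ha hb hab _ hx,
      mixedPot_C_mul]

theorem natDegree_mixedPoly_le {n : ℕ} {p : ℝ[X]} (hp : p.natDegree ≤ n) :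
    (mixedPoly a b p).natDegree ≤ n ∧
      (mixedPoly a b p).coeff n = mixedCoeff a b n * p.coeff n := by
  obtain ⟨P, h1, h2, hP⟩ := exists_polynomial_mixedPot ha hb hab n p hp
  have : mixedPoly a b p = P := eq_of_eval_eq_on_Ioo fun x hx => by
    rw [eval_mixedPoly ha hb hab _ hx, hP x hx]
  rw [this]
  exact ⟨h1, h2⟩

/-- It leaves one outer derivative in `opPoly`, which the symmetry proof integrates by parts. -/
theorem derivative_mixedPoly_one_sub_sq_mul (q : ℝ[X]) :
    derivative (mixedPoly a b ((1 - X ^ 2) * q)) = mixedPoly a b (jacobiDeriv a b q) :=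
  eq_of_eval_eq_on_Ioo fun x hx => by
    rw [eval_mixedPoly ha hb hab _ hx]
    refine ((mixedPoly a b ((1 - X ^ 2) * q)).hasDerivAt x).unique ?_
    refine (hasDerivAt_mixedPot_one_sub_sq_mul ha.1 hb.1 hab.2 hx q).congr_of_eventuallyEq ?_
    filter_upwards [Ioo_mem_nhds hx.1 hx.2] with y hy using eval_mixedPoly ha hb hab _ hy

end

/-! ### The fractional operator as a map of polynomials -/

theorem deriv_eqOn_Ioo {F G : ℝ → ℝ} (h : EqOn F G (Ioo (-1) 1)) :
    EqOn (deriv F) (deriv G) (Ioo (-1) 1) := fun _ hx =>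
  (h.eventuallyEq_of_mem (Ioo_mem_nhds hx.1 hx.2)).deriv_eq

theorem TwiceDiffOnI.congr {F G : ℝ → ℝ} (hG : TwiceDiffOnI G) (h : EqOn F G (Ioo (-1) 1)) :
    TwiceDiffOnI F := fun x hx =>
  ⟨(hG x hx).1.congr_of_eventuallyEq (h.eventuallyEq_of_mem (Ioo_mem_nhds hx.1 hx.2)),
    (hG x hx).2.congr_of_eventuallyEq
      ((deriv_eqOn_Ioo h).eventuallyEq_of_mem (Ioo_mem_nhds hx.1 hx.2))⟩

theorem TwiceDiffOnI.comp_neg {F : ℝ → ℝ} (hF : TwiceDiffOnI F) :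
    TwiceDiffOnI fun x => F (-x) := by
  intro x hx
  have h := hF (-x) (neg_mem_Ioo_neg_one_one hx)
  refine ⟨h.1.comp x differentiableAt_id.neg, ?_⟩
  have e : deriv (fun x => F (-x)) = fun x => -deriv F (-x) := by
    ext y; exact deriv_comp_neg F y
  rw [e]
  exact (h.2.comp x differentiableAt_id.neg).neg

theorem TwiceDiffOnI.const_mul {F : ℝ → ℝ} (hF : TwiceDiffOnI F) (r : ℝ) :
    TwiceDiffOnI fun x => r * F x := by
  intro x hx
  have e : deriv (fun x => r * F x) = fun x => r * deriv F x := by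
    ext y; exact deriv_const_mul_field r
  refine ⟨(hF x hx).1.const_mul r, ?_⟩
  rw [e]
  exact (hF x hx).2.const_mul r

theorem deriv_deriv_linear_combination {F G : ℝ → ℝ} (hF : TwiceDiffOnI F) (hG : TwiceDiffOnI G)
    (r s : ℝ) {x : ℝ} (hx : x ∈ Ioo (-1 : ℝ) 1) :
    deriv (deriv fun x => r * F x + s * G x) x = r * deriv (deriv F) x + s * deriv (deriv G) x := by
  have e : EqOn (deriv fun x => r * F x + s * G x) (fun x => r * deriv F x + s * deriv G x)
      (Ioo (-1) 1) := fun y hy =>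
    (((hF y hy).1.hasDerivAt.const_mul r).add ((hG y hy).1.hasDerivAt.const_mul s)).deriv
  rw [deriv_eqOn_Ioo e hx]
  exact (((hF x hx).2.hasDerivAt.const_mul r).add ((hG x hx).2.hasDerivAt.const_mul s)).deriv

theorem twiceDiffOnI_rightPot {c a b : ℝ} (hc : -1 < c) (ha : 0 < a) (p : ℝ[X]) :
    TwiceDiffOnI (rightPot c a b p) := by
  have : rightPot c a b p = fun x => leftPot c b a (p.comp (-X)) (-x) := by
    ext x; exact rightPot_eq_leftPot c a b p x
  rw [this]
  exact (twiceDiffOnI_leftPot hc ha _).comp_neg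

/-- The weighted polynomial `ω^{a,b} p`, extended by zero. -/
noncomputable def weightedEval (a b : ℝ) (p : ℝ[X]) : ℝ → ℝ :=
  (Ioo (-1 : ℝ) 1).indicator fun x => jacobiWeight a b x * p.eval x

theorem weightedEval_of_mem {a b x : ℝ} (hx : x ∈ Ioo (-1 : ℝ) 1) (p : ℝ[X]) :
    weightedEval a b p x = jacobiWeight a b x * p.eval x := indicator_of_mem hx _

theorem leftInt_weightedEval (a b : ℝ) (p : ℝ[X]) :
    EqOn (leftInt (a + b) (weightedEval a b p)) (fun x => 1 / Real.Gamma (2 - (a + b)) *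
      leftPot (1 - a - b) a b ((1 - X ^ 2) * p) x) (Ioo (-1) 1) := by
  intro x hx
  simp only [leftInt, leftPot]
  congr 1
  rw [intervalIntegral.integral_of_le hx.1.le, intervalIntegral.integral_of_le hx.1.le,
    integral_Ioc_eq_integral_Ioo, integral_Ioc_eq_integral_Ioo]
  refine setIntegral_congr_fun measurableSet_Ioo fun ξ hξ => ?_
  have hξ' : ξ ∈ Ioo (-1 : ℝ) 1 := ⟨hξ.1, hξ.2.trans hx.2⟩
  have h : 0 < x - ξ := by linarith [hξ.2]
  simp only [eval_mul, eval_sub, eval_one, eval_pow, eval_X]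
  rw [weightedEval_of_mem hξ', jacobiWeight_eq_mul hξ', show 1 - a - b = -(a + b - 1) by ring,
    Real.rpow_neg h.le]
  ring

theorem rightInt_weightedEval (a b : ℝ) (p : ℝ[X]) :
    EqOn (rightInt (a + b) (weightedEval a b p)) (fun x => 1 / Real.Gamma (2 - (a + b)) *
      rightPot (1 - a - b) a b ((1 - X ^ 2) * p) x) (Ioo (-1) 1) := by
  intro x hx
  simp only [rightInt, rightPot]
  congr 1
  rw [intervalIntegral.integral_of_le hx.2.le, intervalIntegral.integral_of_le hx.2.le,
    integral_Ioc_eq_integral_Ioo, integral_Ioc_eq_integral_Ioo]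
  refine setIntegral_congr_fun measurableSet_Ioo fun ξ hξ => ?_
  have hξ' : ξ ∈ Ioo (-1 : ℝ) 1 := ⟨hx.1.trans hξ.1, hξ.2⟩
  have h : 0 < ξ - x := by linarith [hξ.1]
  simp only [eval_mul, eval_sub, eval_one, eval_pow, eval_X]
  rw [weightedEval_of_mem hξ', jacobiWeight_eq_mul hξ', show 1 - a - b = -(a + b - 1) by ring,
    Real.rpow_neg h.le]
  ring

theorem twiceDiffOnI_leftInt_weightedEval {a b : ℝ} (hb : 0 < b) (hab : a + b < 2) (p : ℝ[X]) :
    TwiceDiffOnI (leftInt (a + b) (weightedEval a b p)) :=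
  ((twiceDiffOnI_leftPot (by linarith) hb _).const_mul _).congr (leftInt_weightedEval a b p)

theorem twiceDiffOnI_rightInt_weightedEval {a b : ℝ} (ha : 0 < a) (hab : a + b < 2) (p : ℝ[X]) :
    TwiceDiffOnI (rightInt (a + b) (weightedEval a b p)) :=
  ((twiceDiffOnI_rightPot (by linarith) ha _).const_mul _).congr (rightInt_weightedEval a b p)

/-- The two-sided operator on the space `ω^{a,b} ℙ` of weighted polynomials, as a map between
polynomials. -/
noncomputable def opPoly (a b : ℝ) (p : ℝ[X]) : ℝ[X] :=
  C (-(1 / ((Real.sin (Real.pi * b) + Real.sin (Real.pi * a)) * Real.Gamma (2 - a - b)))) *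
    derivative (derivative (mixedPoly a b ((1 - X ^ 2) * p)))

section

variable {a b : ℝ} (ha : a ∈ Ioc (0 : ℝ) 1) (hb : b ∈ Ioc (0 : ℝ) 1) (hab : a + b ∈ Ioo (1 : ℝ) 2)

include ha hb hab

theorem sin_pi_mul_add_pos : 0 < Real.sin (Real.pi * b) + Real.sin (Real.pi * a) := by
  have h0 : ∀ t ∈ Ioc (0 : ℝ) 1, 0 ≤ Real.sin (Real.pi * t) := fun t ht =>
    Real.sin_nonneg_of_nonneg_of_le_pi (mul_nonneg Real.pi_pos.le ht.1.le)
      (by nlinarith [Real.pi_pos, ht.2])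
  have h1 : ∀ t ∈ Ioo (0 : ℝ) 1, 0 < Real.sin (Real.pi * t) := fun t ht =>
    Real.sin_pos_of_pos_of_lt_pi (mul_pos Real.pi_pos ht.1) (by nlinarith [Real.pi_pos, ht.2])
  rcases ha.2.eq_or_lt with h | h
  · exact add_pos_of_pos_of_nonneg (h1 b ⟨hb.1, by linarith [hab.2]⟩) (h0 a ha)
  · exact add_pos_of_nonneg_of_pos (h0 b hb) (h1 a ⟨ha.1, h⟩)

/-- With `S = sin(πb) + sin(πa)` one has `θ = sin(πb)/S` and `1 - θ = sin(πa)/S`, so the two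
fractional integrals assemble into the two-sided potential. -/
theorem fracOp_weightedEval {θ : ℝ}
    (hθ : θ = Real.sin (Real.pi * b) / (Real.sin (Real.pi * b) + Real.sin (Real.pi * a)))
    (p : ℝ[X]) {x : ℝ} (hx : x ∈ Ioo (-1 : ℝ) 1) :
    fracOp (a + b) θ (weightedEval a b p) x = (opPoly a b p).eval x := by
  have hS := (sin_pi_mul_add_pos ha hb hab).ne'
  have hc : -1 < 1 - a - b := by linarith [hab.2]
  have e : EqOn (fun x => (mixedPoly a b ((1 - X ^ 2) * p)).eval x)
      (fun x => Real.sin (Real.pi * b) * leftPot (1 - a - b) a b ((1 - X ^ 2) * p) x +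
        Real.sin (Real.pi * a) * rightPot (1 - a - b) a b ((1 - X ^ 2) * p) x) (Ioo (-1) 1) :=
    fun y hy => eval_mixedPoly ha hb hab _ hy
  have h1 := deriv_eqOn_Ioo (deriv_eqOn_Ioo e) hx
  rw [deriv_deriv_linear_combination (twiceDiffOnI_leftPot hc hb.1 _)
    (twiceDiffOnI_rightPot hc ha.1 _) _ _ hx] at h1
  have e2 : deriv (fun x => (mixedPoly a b ((1 - X ^ 2) * p)).eval x) =
      fun x => (derivative (mixedPoly a b ((1 - X ^ 2) * p))).eval x := by
    ext y; exact Polynomial.deriv _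
  rw [e2, Polynomial.deriv] at h1
  have h2 := deriv_eqOn_Ioo (deriv_eqOn_Ioo (leftInt_weightedEval a b p)) hx
  have h3 := deriv_eqOn_Ioo (deriv_eqOn_Ioo (rightInt_weightedEval a b p)) hx
  have e3 : ∀ (r : ℝ) (F : ℝ → ℝ), deriv (deriv fun x => r * F x) x = r * deriv (deriv F) x := by
    intro r F
    rw [show deriv (fun x => r * F x) = fun x => r * deriv F x by
      ext y; exact deriv_const_mul_field r]
    exact deriv_const_mul_field r
  rw [e3] at h2 h3
  rw [fracOp, leftRL, rightRL, h2, h3, opPoly, eval_mul, eval_C, h1, hθ, sub_sub 2 a b]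
  field_simp
  ring

theorem opPoly_add (p q : ℝ[X]) : opPoly a b (p + q) = opPoly a b p + opPoly a b q := by
  simp only [opPoly, mul_add, mixedPoly_add ha hb hab, derivative_add]

theorem opPoly_C_mul (r : ℝ) (p : ℝ[X]) : opPoly a b (C r * p) = C r * opPoly a b p := by
  simp only [opPoly]
  rw [mul_left_comm, mixedPoly_C_mul ha hb hab, derivative_C_mul, derivative_C_mul, mul_left_comm]

/-- The factor `1 - X²` moves the leading coefficient up two degrees with sign `-1`, the potential
multiplies it by `mixedCoeff`, and two derivatives bring it down with `(n + 2)(n + 1)`. -/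
theorem opPoly_degree {n : ℕ} {p : ℝ[X]} (hp : p.natDegree ≤ n) :
    (opPoly a b p).natDegree ≤ n ∧
      (opPoly a b p).coeff n = pseudoEigenvalue (a + b) a n * p.coeff n := by
  have hX : (1 - X ^ 2 : ℝ[X]).natDegree ≤ 2 :=
    (natDegree_sub_le _ _).trans (max_le (by simp) (by simp))
  have h1 : ((1 - X ^ 2) * p).natDegree ≤ n + 2 := natDegree_mul_le.trans (by omega)
  have h2 : ((1 - X ^ 2) * p).coeff (n + 2) = -p.coeff n := by
    rw [sub_mul, one_mul, coeff_sub, coeff_X_pow_mul, coeff_eq_zero_of_natDegree_lt (by omega),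
      zero_sub]
  obtain ⟨h3, h4⟩ := natDegree_mixedPoly_le ha hb hab h1
  refine ⟨(natDegree_C_mul_le _ _).trans ?_, ?_⟩
  · have := natDegree_derivative_le (derivative (mixedPoly a b ((1 - X ^ 2) * p)))
    have := natDegree_derivative_le (mixedPoly a b ((1 - X ^ 2) * p))
    omega
  · rw [opPoly, coeff_C_mul, coeff_derivative, coeff_derivative, h4, h2, pseudoEigenvalue, mixedCoeff,
      add_sub_cancel_left]
    have g1 := Real.Gamma_mul_Gamma_one_sub (a + b - 1)
    rw [show 1 - (a + b - 1) = 2 - a - b by ring, show Real.pi * (a + b - 1) =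
      Real.pi * (a + b) - Real.pi by ring, Real.sin_sub_pi] at g1
    have g2 : 0 < Real.Gamma (a + b - 1) := Real.Gamma_pos_of_pos (by linarith [hab.1])
    have g3 : 0 < Real.Gamma (2 - a - b) := Real.Gamma_pos_of_pos (by linarith [hab.2])
    have g4 : -Real.sin (Real.pi * (a + b)) ≠ 0 := by
      intro h
      rw [h, div_zero] at g1
      exact (mul_pos g2 g3).ne' g1
    have hS := (sin_pi_mul_add_pos ha hb hab).ne'
    -- The reflection formula at `a + b - 1` trades the sine in the pseudo-eigenvalue for the Gamma
    -- factors of the potential.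
    have g5 : Real.sin (Real.pi * (a + b)) = -(Real.pi / (Real.Gamma (a + b - 1) * Real.Gamma (2 - a - b))) := by
      rw [g1]
      field_simp
    have g6 : (n.factorial : ℝ) ≠ 0 := by exact_mod_cast n.factorial_ne_zero
    rw [g5, Nat.factorial_succ, Nat.factorial_succ, add_comm (Real.sin (Real.pi * a))]
    push_cast
    rw [show (n : ℝ) + 2 + (a + b - 1) = a + b + n + 1 by ring]
    have g7 : (n : ℝ) + 1 ≠ 0 := by positivity
    have g8 : (n : ℝ) + 1 + 1 ≠ 0 := by positivity
    have g2' := g2.ne'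
    have g3' := g3.ne'
    field_simp

theorem pseudoEigenvalue_zero_pos : 0 < pseudoEigenvalue (a + b) a 0 := by
  have hS := sin_pi_mul_add_pos ha hb hab
  have h1 : Real.sin (Real.pi * (a + b)) < 0 := by
    have : Real.sin (Real.pi * (a + b)) = -Real.sin (Real.pi * (a + b) - Real.pi) := by
      rw [Real.sin_sub_pi, neg_neg]
    rw [this, neg_lt_zero]
    exact Real.sin_pos_of_pos_of_lt_pi (by nlinarith [Real.pi_pos, hab.1])
      (by nlinarith [Real.pi_pos, hab.2])
  rw [pseudoEigenvalue, add_sub_cancel_left, add_comm (Real.sin (Real.pi * a))]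
  refine mul_pos (neg_pos.2 (div_neg_of_neg_of_pos h1 hS))
    (div_pos (Real.Gamma_pos_of_pos ?_) (by positivity))
  simp; linarith [hab.1]

theorem pseudoEigenvalue_mono (n : ℕ) :
    pseudoEigenvalue (a + b) a 0 ≤ pseudoEigenvalue (a + b) a n := by
  induction n with
  | zero => exact le_rfl
  | succ n ih =>
    refine ih.trans ?_
    have hpos := (pseudoEigenvalue_zero_pos ha hb hab).trans_le ih
    have h1 : a + b + n + 1 ≠ 0 := by
      have : (0 : ℝ) ≤ n := n.cast_nonneg
      linarith [hab.1]
    have g6 : (n.factorial : ℝ) ≠ 0 := by exact_mod_cast n.factorial_ne_zero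
    -- Consecutive pseudo-eigenvalues have ratio `(α + n + 1)/(n + 1) ≥ 1`.
    have h2 : pseudoEigenvalue (a + b) a (n + 1) =
        pseudoEigenvalue (a + b) a n * ((a + b + n + 1) / (n + 1)) := by
      unfold pseudoEigenvalue
      rw [Nat.factorial_succ]
      push_cast
      rw [show a + b + ((n : ℝ) + 1) + 1 = a + b + n + 1 + 1 by ring, Real.Gamma_add_one h1]
      have : (n : ℝ) + 1 ≠ 0 := by positivity
      field_simp
    rw [h2]
    refine le_mul_of_one_le_right hpos.le ((one_le_div (by positivity)).2 ?_)
    linarith [hab.1]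

end

/-! ### The weighted measure and integration by parts -/

theorem jacobiWeight_pos {γ β x : ℝ} (hx : x ∈ Ioo (-1 : ℝ) 1) : 0 < jacobiWeight γ β x :=
  mul_pos (Real.rpow_pos_of_pos (by linarith [hx.2]) _) (Real.rpow_pos_of_pos (by linarith [hx.1]) _)

theorem measurable_jacobiWeight (γ β : ℝ) : Measurable (jacobiWeight γ β) := by
  unfold jacobiWeight; fun_prop

theorem integral_weightedMeasure (γ β : ℝ) (g : ℝ → ℝ) :
    ∫ x, g x ∂weightedMeasure γ β = ∫ x in Ioo (-1 : ℝ) 1, jacobiWeight γ β x * g x := by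
  rw [weightedMeasure, integral_withDensity_eq_integral_toReal_smul
    (measurable_jacobiWeight γ β).ennreal_ofReal (by simp)]
  refine setIntegral_congr_fun measurableSet_Ioo fun x hx => ?_
  simp only [ENNReal.toReal_ofReal (jacobiWeight_pos hx).le, smul_eq_mul]

theorem integrable_weightedMeasure_iff {γ β : ℝ} {g : ℝ → ℝ} :
    Integrable g (weightedMeasure γ β) ↔
      IntegrableOn (fun x => jacobiWeight γ β x * g x) (Ioo (-1) 1) := by
  rw [weightedMeasure, integrable_withDensity_iff (measurable_jacobiWeight γ β).ennreal_ofReal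
    (by simp)]
  refine integrableOn_congr_fun (fun x hx => ?_) measurableSet_Ioo
  simp only [ENNReal.toReal_ofReal (jacobiWeight_pos hx).le, mul_comm]

theorem ae_weightedMeasure_mem (γ β : ℝ) : ∀ᵐ x ∂weightedMeasure γ β, x ∈ Ioo (-1 : ℝ) 1 :=
  (withDensity_absolutelyContinuous _ _).ae_le (ae_restrict_mem measurableSet_Ioo)

theorem integrable_weightedMeasure_of_continuous {γ β : ℝ} (hγ : -1 < γ) (hβ : -1 < β)
    {g : ℝ → ℝ} (hg : Continuous g) : Integrable g (weightedMeasure γ β) := by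
  rw [integrable_weightedMeasure_iff, ← integrableOn_Ioc_iff_integrableOn_Ioo,
    ← intervalIntegrable_iff_integrableOn_Ioc_of_le (by norm_num)]
  refine (intervalIntegrable_rpow_mul_rpow_mul (p := -1) (q := 1) (by norm_num) hγ hβ
    hg.continuousOn).congr fun x _ => ?_
  simp only [jacobiWeight, sub_neg_eq_add, add_comm x 1]

theorem isFiniteMeasure_weightedMeasure {γ β : ℝ} (hγ : -1 < γ) (hβ : -1 < β) :
    IsFiniteMeasure (weightedMeasure γ β) := by
  have := integrable_weightedMeasure_of_continuous hγ hβ (g := fun _ => 1) continuous_const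
  rcases (integrable_const_iff (c := (1 : ℝ))).1 this with h | h
  · exact absurd h one_ne_zero
  · exact h

theorem integral_weightedMeasure_comp_neg (γ β : ℝ) (g : ℝ → ℝ) :
    ∫ x, g (-x) ∂weightedMeasure γ β = ∫ x, g x ∂weightedMeasure β γ := by
  rw [integral_weightedMeasure, integral_weightedMeasure, ← integral_Ioc_eq_integral_Ioo,
    ← integral_Ioc_eq_integral_Ioo, ← intervalIntegral.integral_of_le (by norm_num),
    ← intervalIntegral.integral_of_le (by norm_num)]
  have := intervalIntegral.integral_comp_neg (a := -1) (b := 1)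
    (fun x => jacobiWeight β γ x * g x)
  rw [neg_neg] at this
  rw [← this]
  simp only [jacobiWeight_neg]

/-- Integration by parts against the Jacobi weight. -/
theorem integral_derivative_mul_weightedMeasure {a b : ℝ} (ha : 0 < a) (hb : 0 < b) (g q : ℝ[X]) :
    ∫ x, (derivative g).eval x * q.eval x ∂weightedMeasure a b =
      -∫ x, g.eval x * (jacobiDeriv a b q).eval x ∂weightedMeasure (a - 1) (b - 1) := by
  have i1 : Integrable (fun x => (derivative g).eval x * q.eval x) (weightedMeasure a b) :=
    integrable_weightedMeasure_of_continuous (by linarith) (by linarith) (by fun_prop)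
  have i2 : Integrable (fun x => g.eval x * (jacobiDeriv a b q).eval x)
      (weightedMeasure (a - 1) (b - 1)) :=
    integrable_weightedMeasure_of_continuous (by linarith) (by linarith) (by fun_prop)
  rw [integrable_weightedMeasure_iff] at i1 i2
  rw [eq_neg_iff_add_eq_zero, integral_weightedMeasure, integral_weightedMeasure,
    ← integral_add i1 i2]
  have i3 := i1.add i2
  rw [← integral_Ioc_eq_integral_Ioo, ← intervalIntegral.integral_of_le (by norm_num)]
  have i4 : IntegrableOn _ (Ioo (-1 : ℝ) 1) volume := i3
  rw [← integrableOn_Ioc_iff_integrableOn_Ioo,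
    ← intervalIntegrable_iff_integrableOn_Ioc_of_le (by norm_num)] at i4
  have key := intervalIntegral.integral_eq_sub_of_hasDerivAt_of_le (a := -1) (b := 1) (by norm_num)
    (f := fun x => g.eval x * (jacobiWeight a b x * q.eval x)) ?_ ?_ i4
  · simp only [Pi.add_apply] at key
    rw [key]
    simp [jacobiWeight, Real.zero_rpow ha.ne', Real.zero_rpow hb.ne']
  · unfold jacobiWeight
    refine ContinuousOn.mul g.continuous.continuousOn (ContinuousOn.mul (ContinuousOn.mul ?_ ?_)
      q.continuous.continuousOn)
    · exact ContinuousOn.rpow_const (by fun_prop) fun ξ _ => Or.inr ha.le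
    · exact ContinuousOn.rpow_const (by fun_prop) fun ξ _ => Or.inr hb.le
  · intro x hx
    refine ((g.hasDerivAt x).mul (hasDerivAt_jacobiWeight_mul hx q)).congr_deriv ?_
    simp only [Pi.add_apply]
    ring

/-! ### Symmetry of the reflected operator -/

/-- The two-sided convolution kernel, reflected. -/
noncomputable def mixedKernel (a b s : ℝ) : ℝ :=
  if s < 0 then Real.sin (Real.pi * b) * (-s) ^ (1 - a - b)
  else Real.sin (Real.pi * a) * s ^ (1 - a - b)

theorem measurable_mixedKernel (a b : ℝ) : Measurable (mixedKernel a b) := by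
  unfold mixedKernel
  exact Measurable.ite measurableSet_Iio (by fun_prop) (by fun_prop)

theorem mixedKernel_nonneg {a b : ℝ} (ha : a ∈ Ioc (0 : ℝ) 1) (hb : b ∈ Ioc (0 : ℝ) 1) (s : ℝ) :
    0 ≤ mixedKernel a b s := by
  have h0 : ∀ t ∈ Ioc (0 : ℝ) 1, 0 ≤ Real.sin (Real.pi * t) := fun t ht =>
    Real.sin_nonneg_of_nonneg_of_le_pi (mul_nonneg Real.pi_pos.le ht.1.le)
      (by nlinarith [Real.pi_pos, ht.2])
  unfold mixedKernel
  split_ifs with h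
  · exact mul_nonneg (h0 b hb) (Real.rpow_nonneg (by linarith) _)
  · exact mul_nonneg (h0 a ha) (Real.rpow_nonneg (by linarith) _)

theorem intervalIntegrable_rightPot {c a b x : ℝ} (hc : -1 < c) (ha : 0 < a)
    (hx : x ∈ Ioo (-1 : ℝ) 1) (p : ℝ[X]) :
    IntervalIntegrable (fun ξ => (ξ - x) ^ c * (jacobiWeight (a - 1) (b - 1) ξ * p.eval ξ))
      volume x 1 := by
  refine (intervalIntegrable_rpow_mul_rpow_mul (c := a - 1) (d := c) hx.2 (by linarith) hc
    (g := fun ξ => (1 + ξ) ^ (b - 1) * p.eval ξ) ?_).congr fun ξ _ => ?_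
  · refine ContinuousOn.mul (ContinuousOn.rpow_const (by fun_prop) fun s hs => Or.inl ?_)
      p.continuous.continuousOn
    have := hs.1; have := hx.1; linarith
  · simp only [jacobiWeight]; ring

section

variable {a b : ℝ} (ha : a ∈ Ioc (0 : ℝ) 1) (hb : b ∈ Ioc (0 : ℝ) 1) (hab : a + b ∈ Ioo (1 : ℝ) 2)

include ha hb hab

/-- Evaluation at `-x` turns the convolution kernel, which is not symmetric in general, into a
function of `x + ξ`. -/
theorem mixedPot_neg_eq_integral (p : ℝ[X]) {x : ℝ} (hx : x ∈ Ioo (-1 : ℝ) 1) :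
    Integrable (fun ξ => mixedKernel a b (x + ξ) * p.eval ξ) (weightedMeasure (a - 1) (b - 1)) ∧
    mixedPot a b p (-x) =
      ∫ ξ, mixedKernel a b (x + ξ) * p.eval ξ ∂weightedMeasure (a - 1) (b - 1) := by
  have hx' := neg_mem_Ioo_neg_one_one hx
  have hc : -1 < 1 - a - b := by linarith [hab.2]
  have i1 := (intervalIntegrable_leftPot (a := a) hc hb.1 hx' p).const_mul (Real.sin (Real.pi * b))
  have i2 := (intervalIntegrable_rightPot (b := b) hc ha.1 hx' p).const_mul (Real.sin (Real.pi * a))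
  have e1 : ∀ ξ ∈ Ioo (-1) (-x), Real.sin (Real.pi * b) * ((-x - ξ) ^ (1 - a - b) *
      (jacobiWeight (a - 1) (b - 1) ξ * p.eval ξ)) = jacobiWeight (a - 1) (b - 1) ξ *
      (mixedKernel a b (x + ξ) * p.eval ξ) := by
    intro ξ hξ
    rw [mixedKernel, if_pos (by linarith [hξ.2]), neg_add']; ring
  have e2 : ∀ ξ ∈ Ioo (-x) 1, Real.sin (Real.pi * a) * ((ξ - -x) ^ (1 - a - b) *
      (jacobiWeight (a - 1) (b - 1) ξ * p.eval ξ)) = jacobiWeight (a - 1) (b - 1) ξ *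
      (mixedKernel a b (x + ξ) * p.eval ξ) := by
    intro ξ hξ
    rw [mixedKernel, if_neg (by linarith [hξ.1]), sub_neg_eq_add, add_comm ξ x]; ring
  have j1 : IntervalIntegrable (fun ξ => jacobiWeight (a - 1) (b - 1) ξ *
      (mixedKernel a b (x + ξ) * p.eval ξ)) volume (-1) (-x) := by
    rw [intervalIntegrable_iff_integrableOn_Ioc_of_le hx'.1.le,
      integrableOn_Ioc_iff_integrableOn_Ioo] at i1 ⊢
    exact i1.congr_fun e1 measurableSet_Ioo
  have j2 : IntervalIntegrable (fun ξ => jacobiWeight (a - 1) (b - 1) ξ *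
      (mixedKernel a b (x + ξ) * p.eval ξ)) volume (-x) 1 := by
    rw [intervalIntegrable_iff_integrableOn_Ioc_of_le hx'.2.le,
      integrableOn_Ioc_iff_integrableOn_Ioo] at i2 ⊢
    exact i2.congr_fun e2 measurableSet_Ioo
  constructor
  · rw [integrable_weightedMeasure_iff, ← integrableOn_Ioc_iff_integrableOn_Ioo,
      ← intervalIntegrable_iff_integrableOn_Ioc_of_le (by norm_num)]
    exact j1.trans j2
  · rw [integral_weightedMeasure, ← integral_Ioc_eq_integral_Ioo,
      ← intervalIntegral.integral_of_le (by norm_num),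
      ← intervalIntegral.integral_add_adjacent_intervals j1 j2, mixedPot, leftPot, rightPot,
      ← intervalIntegral.integral_const_mul, ← intervalIntegral.integral_const_mul,
      intervalIntegral.integral_of_le hx'.1.le, intervalIntegral.integral_of_le hx'.1.le,
      intervalIntegral.integral_of_le hx'.2.le, intervalIntegral.integral_of_le hx'.2.le]
    simp only [integral_Ioc_eq_integral_Ioo]
    rw [setIntegral_congr_fun measurableSet_Ioo e1, setIntegral_congr_fun measurableSet_Ioo e2]

theorem integrable_mixedKernel_mul (r s : ℝ[X]) :
    Integrable (Function.uncurry fun x ξ => mixedKernel a b (x + ξ) * r.eval ξ * s.eval x)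
      ((weightedMeasure (a - 1) (b - 1)).prod (weightedMeasure (a - 1) (b - 1))) := by
  have := isFiniteMeasure_weightedMeasure (γ := a - 1) (β := b - 1) (by linarith [ha.1])
    (by linarith [hb.1])
  have hmeas : Measurable fun z : ℝ × ℝ => mixedKernel a b (z.1 + z.2) :=
    (measurable_mixedKernel a b).comp (by fun_prop)
  have h1 : Integrable (fun z : ℝ × ℝ => mixedKernel a b (z.1 + z.2))
      ((weightedMeasure (a - 1) (b - 1)).prod (weightedMeasure (a - 1) (b - 1))) := by
    rw [integrable_prod_iff hmeas.aestronglyMeasurable]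
    constructor
    · filter_upwards [ae_weightedMeasure_mem (a - 1) (b - 1)] with x hx
      simpa using (mixedPot_neg_eq_integral ha hb hab 1 hx).1
    -- The kernel is nonnegative, so its inner integral is the potential of `1`, the constant `π`;
    -- integrability on the product is then immediate.
    · refine (integrable_const Real.pi).congr ?_
      filter_upwards [ae_weightedMeasure_mem (a - 1) (b - 1)] with x hx
      have h := (mixedPot_neg_eq_integral ha hb hab 1 hx).2
      rw [mixedPot_one ha hb hab.2 (neg_mem_Ioo_neg_one_one hx)] at h
      simp only [eval_one, mul_one] at h
      simp only [Real.norm_of_nonneg (mixedKernel_nonneg ha hb _)]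
      exact h
  obtain ⟨M, hM⟩ := (isCompact_Icc (a := (-1 : ℝ)) (b := 1)).exists_bound_of_continuousOn
    r.continuous.continuousOn
  obtain ⟨K, hK⟩ := (isCompact_Icc (a := (-1 : ℝ)) (b := 1)).exists_bound_of_continuousOn
    s.continuous.continuousOn
  have hM0 : 0 ≤ M := (norm_nonneg _).trans (hM 0 (by simp))
  have h2 : Integrable (fun z : ℝ × ℝ => mixedKernel a b (z.1 + z.2) * (r.eval z.2 * s.eval z.1))
      ((weightedMeasure (a - 1) (b - 1)).prod (weightedMeasure (a - 1) (b - 1))) := by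
    refine h1.mul_bdd (c := M * K) ?_ ?_
    · exact Continuous.aestronglyMeasurable (by fun_prop)
    · filter_upwards [Measure.quasiMeasurePreserving_fst.ae (ae_weightedMeasure_mem (a - 1) (b - 1)),
        Measure.quasiMeasurePreserving_snd.ae (ae_weightedMeasure_mem (a - 1) (b - 1))] with z hz1 hz2
      rw [norm_mul]
      exact mul_le_mul (hM _ (Ioo_subset_Icc_self hz2)) (hK _ (Ioo_subset_Icc_self hz1))
        (norm_nonneg _) hM0
  refine h2.congr (Eventually.of_forall fun z => ?_)
  simp only [Function.uncurry]
  ring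

theorem integral_mixedPot_neg_mul_comm (r s : ℝ[X]) :
    ∫ x, mixedPot a b r (-x) * s.eval x ∂weightedMeasure (a - 1) (b - 1) =
      ∫ x, mixedPot a b s (-x) * r.eval x ∂weightedMeasure (a - 1) (b - 1) := by
  have := isFiniteMeasure_weightedMeasure (γ := a - 1) (β := b - 1) (by linarith [ha.1])
    (by linarith [hb.1])
  have e : ∀ r s : ℝ[X], ∫ x, mixedPot a b r (-x) * s.eval x ∂weightedMeasure (a - 1) (b - 1) =
      ∫ x, ∫ ξ, mixedKernel a b (x + ξ) * r.eval ξ * s.eval x ∂weightedMeasure (a - 1) (b - 1)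
        ∂weightedMeasure (a - 1) (b - 1) := by
    intro r s
    refine integral_congr_ae ?_
    filter_upwards [ae_weightedMeasure_mem (a - 1) (b - 1)] with x hx
    rw [integral_mul_const, (mixedPot_neg_eq_integral ha hb hab r hx).2]
  rw [e, e, integral_integral_swap (integrable_mixedKernel_mul ha hb hab r s)]
  refine integral_congr_ae (Eventually.of_forall fun x => integral_congr_ae
    (Eventually.of_forall fun ξ => ?_))
  simp only [add_comm ξ x]
  ring

/-- The reflected operator is symmetric with respect to the Jacobi weight. -/
theorem integral_opPoly_comp_neg_mul_comm (p q : ℝ[X]) :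
    ∫ x, ((opPoly a b p).comp (-X)).eval x * q.eval x ∂weightedMeasure a b =
      ∫ x, ((opPoly a b q).comp (-X)).eval x * p.eval x ∂weightedMeasure a b := by
  -- The sign from integrating by parts cancels the sign from differentiating the reflection. What
  -- remains is the symmetric kernel form in `jacobiDeriv a b p` and `jacobiDeriv a b q`.
  have e : ∀ p q : ℝ[X], ∫ x, ((opPoly a b p).comp (-X)).eval x * q.eval x ∂weightedMeasure a b =
      -(1 / ((Real.sin (Real.pi * b) + Real.sin (Real.pi * a)) * Real.Gamma (2 - a - b))) *
      ∫ x, mixedPot a b (jacobiDeriv a b p) (-x) * (jacobiDeriv a b q).eval x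
        ∂weightedMeasure (a - 1) (b - 1) := by
    intro p q
    have h := integral_derivative_mul_weightedMeasure ha.1 hb.1
      ((mixedPoly a b (jacobiDeriv a b p)).comp (-X)) q
    have h2 : ∫ x, mixedPot a b (jacobiDeriv a b p) (-x) * (jacobiDeriv a b q).eval x
        ∂weightedMeasure (a - 1) (b - 1) =
        ∫ x, ((mixedPoly a b (jacobiDeriv a b p)).comp (-X)).eval x * (jacobiDeriv a b q).eval x
        ∂weightedMeasure (a - 1) (b - 1) := by
      refine integral_congr_ae ?_
      filter_upwards [ae_weightedMeasure_mem (a - 1) (b - 1)] with x hx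
      rw [eval_comp, eval_neg, eval_X,
        eval_mixedPoly ha hb hab _ (neg_mem_Ioo_neg_one_one hx)]
    rw [h2, neg_mul, ← mul_neg, ← h, ← integral_const_mul]
    refine integral_congr_ae (Eventually.of_forall fun x => ?_)
    simp only [opPoly, derivative_mixedPoly_one_sub_sq_mul ha hb hab, derivative_comp, mul_comp, C_comp,
      eval_mul, eval_C, derivative_neg, derivative_X, eval_neg, eval_one]
    ring
  rw [e, e, integral_mixedPot_neg_mul_comm ha hb hab]

end

/-! ### Symmetric triangular operators and orthogonal polynomials -/

theorem exists_forall_mem_eq {V : Type*} [AddCommGroup V] [Module ℝ V] (B : V →ₗ[ℝ] V →ₗ[ℝ] ℝ)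
    (W : Submodule ℝ V) [FiniteDimensional ℝ W]
    (hB : ∀ p ∈ W, (∀ q ∈ W, B p q = 0) → p = 0) (ℓ : V →ₗ[ℝ] ℝ) :
    ∃ p ∈ W, ∀ q ∈ W, B p q = ℓ q := by
  have hinj : Function.Injective (B.domRestrict₁₂ W W) := by
    rw [← LinearMap.ker_eq_bot, LinearMap.ker_eq_bot']
    intro p hp
    refine Subtype.ext (hB p p.2 fun q hq => ?_)
    have := LinearMap.congr_fun hp ⟨q, hq⟩
    exact this
  have hsurj := (LinearMap.injective_iff_surjective_of_finrank_eq_finrank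
    (Subspace.dual_finrank_eq (K := ℝ) (V := W)).symm).1 hinj
  obtain ⟨p, hp⟩ := hsurj (ℓ.domRestrict W)
  refine ⟨p, p.2, fun q hq => ?_⟩
  exact LinearMap.congr_fun hp ⟨q, hq⟩

theorem degree_lt_succ_iff_natDegree_le {p : ℝ[X]} {n : ℕ} :
    p.degree < (n + 1 : ℕ) ↔ p.natDegree ≤ n := by
  rw [degree_lt_iff_coeff_zero, natDegree_le_iff_coeff_eq_zero]
  exact Iff.rfl

theorem degree_lt_of_natDegree_preserved {T : ℝ[X] → ℝ[X]} (hT0 : T 0 = 0)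
    (hT : ∀ n p, p.natDegree ≤ n → (T p).natDegree ≤ n) {n : ℕ} {p : ℝ[X]} (hp : p.degree < n) :
    (T p).degree < n := by
  rcases n with - | n
  · have : p = 0 := by simpa [degree_lt_iff_coeff_zero, Polynomial.ext_iff] using hp
    rw [this, hT0, ← this]; exact hp
  · rw [degree_lt_succ_iff_natDegree_le] at hp ⊢
    exact hT n p hp

/-- Subtract from `X ^ n` its orthogonal projection `r` onto the lower degrees. -/
theorem exists_monic_orthogonal (B : ℝ[X] →ₗ[ℝ] ℝ[X] →ₗ[ℝ] ℝ)
    (hpos : ∀ p, B p p = 0 → p = 0) (n : ℕ) :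
    ∃ P : ℝ[X], P.natDegree ≤ n ∧ P.coeff n = 1 ∧ ∀ q : ℝ[X], q.degree < n → B P q = 0 := by
  obtain ⟨r, hr, h⟩ := exists_forall_mem_eq B (degreeLT ℝ n)
    (fun p hp h => hpos p (h p hp)) (B (X ^ n))
  rw [mem_degreeLT] at hr
  refine ⟨X ^ n - r, (natDegree_sub_le _ _).trans (max_le (by simp) (natDegree_le_of_degree_le hr.le)),
    ?_, fun q hq => ?_⟩
  · rw [coeff_sub, coeff_X_pow_self, coeff_eq_zero_of_degree_lt hr, sub_zero]
  · rw [map_sub, LinearMap.sub_apply, h q (mem_degreeLT.2 hq), sub_self]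

/-- A symmetric operator on polynomials that preserves degrees is diagonalized by the orthogonal
polynomials, so it is bounded below by a bound for its diagonal. -/
theorem sq_mul_le_of_triangular (B : ℝ[X] →ₗ[ℝ] ℝ[X] →ₗ[ℝ] ℝ) (hsymm : ∀ p q, B p q = B q p)
    (hnonneg : ∀ p, 0 ≤ B p p) (hpos : ∀ p, B p p = 0 → p = 0) (T : ℝ[X] →ₗ[ℝ] ℝ[X])
    (hT : ∀ p q, B (T p) q = B p (T q)) {m : ℝ} {d : ℕ → ℝ} (hm : ∀ n, m ^ 2 ≤ d n ^ 2)
    (hdeg : ∀ n p, p.natDegree ≤ n → (T p).natDegree ≤ n)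
    (hcoeff : ∀ n p, p.natDegree ≤ n → (T p).coeff n = d n * p.coeff n) (p : ℝ[X]) :
    m ^ 2 * B p p ≤ B (T p) (T p) := by
  suffices h : ∀ (n : ℕ) (p : ℝ[X]), p.degree < n → m ^ 2 * B p p ≤ B (T p) (T p) from
    h (p.natDegree + 1) p (degree_lt_succ_iff_natDegree_le.2 le_rfl)
  intro n
  induction n with
  | zero =>
    intro p hp
    have : p = 0 := by simpa [degree_lt_iff_coeff_zero, Polynomial.ext_iff] using hp
    simp [this]
  | succ n ih =>
    intro p hp
    rw [degree_lt_succ_iff_natDegree_le] at hp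
    obtain ⟨P, hPd, hPc, hP⟩ := exists_monic_orthogonal B hpos n
    have key : ∀ s : ℝ[X], s.natDegree ≤ n → s.coeff n = 0 → s.degree < n := by
      intro s hs h0
      rw [degree_lt_iff_coeff_zero]
      intro k hk
      rcases hk.eq_or_lt with rfl | hk
      · exact h0
      · exact coeff_eq_zero_of_natDegree_lt (hs.trans_lt hk)
    have hTlt : ∀ s : ℝ[X], s.degree < n → (T s).degree < n := fun s hs =>
      degree_lt_of_natDegree_preserved (map_zero T) hdeg hs
    -- The difference has degree below `n`. Both `P` and, by symmetry of `T`, `T P` are orthogonal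
    -- to such polynomials, so the difference is orthogonal to itself.
    have hTP : T P = d n • P := by
      have h1 : (T P - d n • P).degree < n := by
        refine key _ ((natDegree_sub_le _ _).trans (max_le (hdeg n P hPd)
          ((natDegree_smul_le _ _).trans hPd))) ?_
        rw [coeff_sub, hcoeff n P hPd, coeff_smul, smul_eq_mul, sub_self]
      have h2 : B (T P - d n • P) (T P - d n • P) = 0 := by
        have h3 : ∀ s, B (T P - d n • P) s = B (T P) s - d n * B P s := fun s => by
          rw [map_sub, LinearMap.sub_apply, map_smul, LinearMap.smul_apply, smul_eq_mul]
        rw [h3, hT, hP _ (hTlt _ h1), hP _ h1, mul_zero, sub_zero]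
      exact sub_eq_zero.1 (hpos _ h2)
    set c := p.coeff n with hc
    have hr : (p - c • P).degree < n := by
      refine key _ ((natDegree_sub_le _ _).trans (max_le hp ((natDegree_smul_le _ _).trans hPd))) ?_
      rw [coeff_sub, coeff_smul, hPc, smul_eq_mul, mul_one, sub_self]
    set r := p - c • P with hrdef
    have hp' : p = c • P + r := by rw [hrdef]; abel
    have hTp : T p = (c * d n) • P + T r := by rw [hp', map_add, map_smul, hTP, smul_smul]
    have e1 : B p p = c ^ 2 * B P P + B r r := by
      rw [hp']
      simp only [map_add, map_smul, LinearMap.add_apply, LinearMap.smul_apply, smul_eq_mul,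
        hsymm r P, hP r hr]
      ring
    have e2 : B (T p) (T p) = (c * d n) ^ 2 * B P P + B (T r) (T r) := by
      rw [hTp]
      simp only [map_add, map_smul, LinearMap.add_apply, LinearMap.smul_apply, smul_eq_mul,
        hsymm (T r) P, hP (T r) (hTlt r hr)]
      ring
    rw [e1, e2, mul_pow]
    have h1 := ih r hr
    have h2 := mul_le_mul_of_nonneg_right (hm n) (mul_nonneg (sq_nonneg c) (hnonneg P))
    linarith

/-- The inner product of `L²` for the Jacobi weight, on polynomials. -/
noncomputable def jacobiForm {a b : ℝ} (ha : -1 < a) (hb : -1 < b) : ℝ[X] →ₗ[ℝ] ℝ[X] →ₗ[ℝ] ℝ :=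
  LinearMap.mk₂ ℝ (fun p q => ∫ x, p.eval x * q.eval x ∂weightedMeasure a b)
    (fun p q r => by
      rw [← integral_add (integrable_weightedMeasure_of_continuous ha hb (by fun_prop))
        (integrable_weightedMeasure_of_continuous ha hb (by fun_prop))]
      simp only [eval_add, add_mul])
    (fun c p q => by
      rw [smul_eq_mul, ← integral_const_mul]
      simp only [eval_smul, smul_eq_mul, mul_assoc])
    (fun p q r => by
      rw [← integral_add (integrable_weightedMeasure_of_continuous ha hb (by fun_prop))
        (integrable_weightedMeasure_of_continuous ha hb (by fun_prop))]
      simp only [eval_add, mul_add])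
    (fun c p q => by
      rw [smul_eq_mul, ← integral_const_mul]
      simp only [eval_smul, smul_eq_mul, mul_left_comm])

theorem jacobiForm_apply {a b : ℝ} (ha : -1 < a) (hb : -1 < b) (p q : ℝ[X]) :
    jacobiForm ha hb p q = ∫ x, p.eval x * q.eval x ∂weightedMeasure a b := rfl

theorem jacobiForm_self_nonneg {a b : ℝ} (ha : -1 < a) (hb : -1 < b) (p : ℝ[X]) :
    0 ≤ jacobiForm ha hb p p := integral_nonneg fun x => mul_self_nonneg (p.eval x)

theorem eq_zero_of_jacobiForm_self {a b : ℝ} (ha : -1 < a) (hb : -1 < b) {p : ℝ[X]}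
    (h : jacobiForm ha hb p p = 0) : p = 0 := by
  rw [jacobiForm_apply, integral_eq_zero_iff_of_nonneg (fun x => mul_self_nonneg (p.eval x))
    (integrable_weightedMeasure_of_continuous ha hb (by fun_prop)), EventuallyEq,
    weightedMeasure, ae_withDensity_iff (measurable_jacobiWeight a b).ennreal_ofReal] at h
  have h1 : (fun x => p.eval x) =ᵐ[volume.restrict (Ioo (-1 : ℝ) 1)] fun _ => 0 := by
    filter_upwards [h, ae_restrict_mem measurableSet_Ioo] with x hx hxI
    exact mul_self_eq_zero.1 (hx (by simpa using jacobiWeight_pos hxI))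
  have h2 := Measure.eqOn_open_of_ae_eq h1 isOpen_Ioo p.continuous.continuousOn continuousOn_const
  exact eq_of_eval_eq_on_Ioo fun x hx => (h2 hx).trans eval_zero.symm

section

variable {a b : ℝ} (ha : a ∈ Ioc (0 : ℝ) 1) (hb : b ∈ Ioc (0 : ℝ) 1) (hab : a + b ∈ Ioo (1 : ℝ) 2)

/-- `opPoly` followed by the reflection `x ↦ -x`, as a linear map. -/
noncomputable def reflectedOp : ℝ[X] →ₗ[ℝ] ℝ[X] where
  toFun p := (opPoly a b p).comp (-X)
  map_add' p q := by rw [opPoly_add ha hb hab, add_comp]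
  map_smul' r p := by
    rw [smul_eq_C_mul, opPoly_C_mul ha hb hab, mul_comp, C_comp, RingHom.id_apply, smul_eq_C_mul]

include ha hb hab

/-- Reflection exchanges the weights `ω^{b,a}` and `ω^{a,b}` and multiplies the diagonal entries by
`(-1)^n`, which is lost on squaring. -/
theorem sq_pseudoEigenvalue_mul_le (p : ℝ[X]) :
    pseudoEigenvalue (a + b) a 0 ^ 2 * ∫ x, p.eval x * p.eval x ∂weightedMeasure a b ≤
      ∫ x, (opPoly a b p).eval x * (opPoly a b p).eval x ∂weightedMeasure b a := by
  have ha' : -1 < a := by linarith [ha.1]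
  have hb' : -1 < b := by linarith [hb.1]
  have hsymm : ∀ p q, jacobiForm ha' hb' p q = jacobiForm ha' hb' q p := fun p q => by
    simp only [jacobiForm_apply, mul_comm]
  have h := sq_mul_le_of_triangular (jacobiForm ha' hb') hsymm (jacobiForm_self_nonneg ha' hb')
    (fun p => eq_zero_of_jacobiForm_self ha' hb') (reflectedOp ha hb hab) (fun p q => ?_)
    (m := pseudoEigenvalue (a + b) a 0) (d := fun n => (-1) ^ n * pseudoEigenvalue (a + b) a n)
    (fun n => ?_) (fun n p hp => ?_) (fun n p hp => ?_) p
  · refine h.trans_eq ?_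
    rw [jacobiForm_apply, ← integral_weightedMeasure_comp_neg]
    simp only [reflectedOp, LinearMap.coe_mk, AddHom.coe_mk, eval_comp, eval_neg, eval_X, neg_neg]
  · rw [hsymm p]
    exact integral_opPoly_comp_neg_mul_comm ha hb hab p q
  · rw [mul_pow, ← pow_mul, mul_comm n 2, pow_mul, neg_one_sq, one_pow, one_mul]
    exact pow_le_pow_left₀ (pseudoEigenvalue_zero_pos ha hb hab).le
      (pseudoEigenvalue_mono ha hb hab n) 2
  · have := (opPoly_degree ha hb hab hp).1
    exact natDegree_comp_le.trans (by simpa using this)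
  · have := (opPoly_degree ha hb hab hp).2
    simp only [reflectedOp, LinearMap.coe_mk, AddHom.coe_mk]
    rw [show (-X : ℝ[X]) = C (-1) * X by simp, comp_C_mul_X_coeff, this]; ring

end

/-! ### The Petrov-Galerkin scheme: stability and solvability -/

theorem pairing_weightedEval (γ β : ℝ) (g : ℝ → ℝ) (q : ℝ[X]) :
    pairing g (weightedEval γ β q) = ∫ x, g x * q.eval x ∂weightedMeasure γ β := by
  rw [integral_weightedMeasure, pairing]
  refine setIntegral_congr_fun measurableSet_Ioo fun x hx => ?_
  simp only [weightedEval_of_mem hx]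
  ring

theorem weightedEval_ae_eq (γ β γ' β' : ℝ) (p : ℝ[X]) :
    weightedEval γ β p =ᵐ[weightedMeasure γ' β'] fun x => jacobiWeight γ β x * p.eval x := by
  filter_upwards [ae_weightedMeasure_mem γ' β'] with x hx using weightedEval_of_mem hx p

theorem continuous_jacobiWeight {γ β : ℝ} (hγ : 0 ≤ γ) (hβ : 0 ≤ β) :
    Continuous (jacobiWeight γ β) := by
  unfold jacobiWeight
  exact ((continuous_const.sub continuous_id).rpow_const fun _ => Or.inr hγ).mul
    ((continuous_const.add continuous_id).rpow_const fun _ => Or.inr hβ)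

theorem memLp_two_of_continuous {γ β : ℝ} (hγ : -1 < γ) (hβ : -1 < β) {g : ℝ → ℝ}
    (hg : Continuous g) : MemLp g 2 (weightedMeasure γ β) :=
  (memLp_two_iff_integrable_sq hg.aestronglyMeasurable).2
    (integrable_weightedMeasure_of_continuous hγ hβ (by fun_prop))

theorem norm_toLp_sq_eq_integral {μ : Measure ℝ} {g : ℝ → ℝ} (hg : MemLp g 2 μ) :
    ‖hg.toLp g‖ ^ 2 = ∫ x, g x * g x ∂μ := by
  rw [← real_inner_self_eq_norm_sq, L2.inner_def]
  refine integral_congr_ae ?_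
  filter_upwards [hg.coeFn_toLp] with x hx
  simp [hx, sq]

theorem inner_toLp_eq_integral {μ : Measure ℝ} {f g : ℝ → ℝ} (hf : MemLp f 2 μ)
    (hg : MemLp g 2 μ) : inner ℝ (hf.toLp f) (hg.toLp g) = ∫ x, f x * g x ∂μ := by
  rw [L2.inner_def]
  refine integral_congr_ae ?_
  filter_upwards [hf.coeFn_toLp, hg.coeFn_toLp] with x hx hx'
  simp [hx, hx', mul_comm]

/-- The product of the two weights is `(1 - x²)^{a+b} ≤ 1`. -/
theorem integral_jacobiWeight_mul_sq_le {a b : ℝ} (ha : 0 < a) (hb : 0 < b) (p : ℝ[X]) :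
    ∫ x, jacobiWeight a b x * p.eval x * (jacobiWeight a b x * p.eval x) ∂weightedMeasure b a ≤
      ∫ x, p.eval x * p.eval x ∂weightedMeasure a b := by
  have hw := continuous_jacobiWeight ha.le hb.le
  have i1 := (integrable_weightedMeasure_iff (γ := b) (β := a)).1
    (integrable_weightedMeasure_of_continuous (by linarith) (by linarith)
      (g := fun x => jacobiWeight a b x * p.eval x * (jacobiWeight a b x * p.eval x))
      (by fun_prop))
  have i2 := (integrable_weightedMeasure_iff (γ := a) (β := b)).1
    (integrable_weightedMeasure_of_continuous (by linarith) (by linarith)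
      (g := fun x => p.eval x * p.eval x) (by fun_prop))
  rw [integral_weightedMeasure, integral_weightedMeasure]
  refine setIntegral_mono_on i1 i2 measurableSet_Ioo fun x hx => ?_
  have h1 : jacobiWeight b a x * jacobiWeight a b x ≤ 1 := by
    have hx1 : 0 < 1 - x := by linarith [hx.2]
    have hx2 : 0 < 1 + x := by linarith [hx.1]
    have e : jacobiWeight b a x * jacobiWeight a b x = ((1 - x) * (1 + x)) ^ (a + b) := by
      rw [Real.mul_rpow hx1.le hx2.le, Real.rpow_add hx1, Real.rpow_add hx2, jacobiWeight, jacobiWeight]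
      ring
    rw [e]
    exact Real.rpow_le_one (mul_pos hx1 hx2).le (by nlinarith [sq_nonneg x]) (by linarith)
  have h2 : 0 ≤ jacobiWeight a b x * (p.eval x * p.eval x) :=
    mul_nonneg (jacobiWeight_pos hx).le (mul_self_nonneg _)
  calc _ = (jacobiWeight b a x * jacobiWeight a b x) * (jacobiWeight a b x * (p.eval x * p.eval x)) := by
        ring
    _ ≤ _ := mul_le_of_le_one_left h2 h1

theorem mem_weightedPoly_iff {γ β : ℝ} {N : ℕ} {u : ℝ → ℝ} :
    u ∈ weightedPoly γ β N ↔ ∃ p ∈ degreeLT ℝ (N + 1), u = weightedEval γ β p := by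
  simp only [weightedPoly, mem_ofPred_eq, mem_degreeLT, degree_lt_succ_iff_natDegree_le, weightedEval]

section

variable {a b : ℝ} (ha : a ∈ Ioc (0 : ℝ) 1) (hb : b ∈ Ioc (0 : ℝ) 1) (hab : a + b ∈ Ioo (1 : ℝ) 2)

/-- The bilinear form of the Petrov-Galerkin scheme, on polynomials. -/
noncomputable def schemeForm (μ : ℝ) : ℝ[X] →ₗ[ℝ] ℝ[X] →ₗ[ℝ] ℝ :=
  LinearMap.mk₂ ℝ (fun p q => ∫ x, ((opPoly a b p).eval x + μ * (jacobiWeight a b x * p.eval x)) *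
      q.eval x ∂weightedMeasure b a)
    (fun p q r => by
      have hw := continuous_jacobiWeight ha.1.le hb.1.le
      rw [← integral_add (integrable_weightedMeasure_of_continuous (by linarith [hb.1])
        (by linarith [ha.1]) (by fun_prop)) (integrable_weightedMeasure_of_continuous
        (by linarith [hb.1]) (by linarith [ha.1]) (by fun_prop))]
      refine integral_congr_ae (Eventually.of_forall fun x => ?_)
      simp only [opPoly_add ha hb hab, eval_add]
      ring)
    (fun c p q => by
      rw [smul_eq_mul, ← integral_const_mul]
      refine integral_congr_ae (Eventually.of_forall fun x => ?_)
      simp only [smul_eq_C_mul, opPoly_C_mul ha hb hab, eval_mul, eval_C]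
      ring)
    (fun p q r => by
      have hw := continuous_jacobiWeight ha.1.le hb.1.le
      rw [← integral_add (integrable_weightedMeasure_of_continuous (by linarith [hb.1])
        (by linarith [ha.1]) (by fun_prop)) (integrable_weightedMeasure_of_continuous
        (by linarith [hb.1]) (by linarith [ha.1]) (by fun_prop))]
      refine integral_congr_ae (Eventually.of_forall fun x => ?_)
      simp only [eval_add]
      ring)
    (fun c p q => by
      rw [smul_eq_mul, ← integral_const_mul]
      refine integral_congr_ae (Eventually.of_forall fun x => ?_)
      simp only [smul_eq_C_mul, eval_mul, eval_C]
      ring)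

theorem schemeForm_apply (μ : ℝ) (p q : ℝ[X]) :
    schemeForm ha hb hab μ p q = (∫ x, (opPoly a b p).eval x * q.eval x ∂weightedMeasure b a) +
      μ * ∫ x, jacobiWeight a b x * p.eval x * q.eval x ∂weightedMeasure b a := by
  have hw := continuous_jacobiWeight ha.1.le hb.1.le
  rw [← integral_const_mul, ← integral_add (integrable_weightedMeasure_of_continuous
    (by linarith [hb.1]) (by linarith [ha.1]) (by fun_prop))
    (integrable_weightedMeasure_of_continuous (by linarith [hb.1]) (by linarith [ha.1])
    (by fun_prop))]
  refine integral_congr_ae (Eventually.of_forall fun x => ?_)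
  ring

/-- The linear functional `q ↦ (f, ω^{γ,β} q)` on polynomials. -/
noncomputable def loadFunctional {γ β : ℝ} (hγ : -1 < γ) (hβ : -1 < β) {f : ℝ → ℝ}
    (hf : MemLp f 2 (weightedMeasure γ β)) : ℝ[X] →ₗ[ℝ] ℝ where
  toFun q := ∫ x, f x * q.eval x ∂weightedMeasure γ β
  map_add' p q := by
    have h : ∀ p : ℝ[X], Integrable (fun x => f x * p.eval x) (weightedMeasure γ β) := fun p =>
      hf.integrable_mul (memLp_two_of_continuous hγ hβ p.continuous)
    rw [← integral_add (h p) (h q)]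
    simp only [eval_add, mul_add]
  map_smul' r q := by
    rw [RingHom.id_apply, smul_eq_mul, ← integral_const_mul]
    simp only [eval_smul, smul_eq_mul, mul_left_comm]

include ha hb hab

theorem isPGSolution_weightedEval_iff {θ μ : ℝ} {N : ℕ} {f : ℝ → ℝ}
    (hθ : θ = Real.sin (Real.pi * b) / (Real.sin (Real.pi * b) + Real.sin (Real.pi * a)))
    {p : ℝ[X]} (hp : p ∈ degreeLT ℝ (N + 1)) :
    IsPGSolution (a + b) θ a μ N f (weightedEval a b p) ↔ ∀ q ∈ degreeLT ℝ (N + 1),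
      schemeForm ha hb hab μ p q = ∫ x, f x * q.eval x ∂weightedMeasure b a := by
  have e : ∀ q : ℝ[X], pairing (fracOp (a + b) θ (weightedEval a b p)) (weightedEval b a q) +
      μ * pairing (weightedEval a b p) (weightedEval b a q) = schemeForm ha hb hab μ p q := by
    intro q
    rw [schemeForm_apply, pairing_weightedEval, pairing_weightedEval]
    congr 1
    · refine integral_congr_ae ?_
      filter_upwards [ae_weightedMeasure_mem b a] with x hx
      rw [fracOp_weightedEval ha hb hab hθ p hx]
    · congr 1
      refine integral_congr_ae ?_
      filter_upwards [weightedEval_ae_eq a b b a p] with x hx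
      rw [hx]
  rw [IsPGSolution, add_sub_cancel_left]
  constructor
  · rintro ⟨-, h⟩ q hq
    rw [← e, h _ (mem_weightedPoly_iff.2 ⟨q, hq, rfl⟩), pairing_weightedEval]
  · refine fun h => ⟨mem_weightedPoly_iff.2 ⟨p, hp, rfl⟩, ?_⟩
    rintro v hv
    obtain ⟨q, hq, rfl⟩ := mem_weightedPoly_iff.1 hv
    rw [e, h q hq, pairing_weightedEval]

theorem opPoly_mem_degreeLT {N : ℕ} {p : ℝ[X]} (hp : p ∈ degreeLT ℝ (N + 1)) :
    opPoly a b p ∈ degreeLT ℝ (N + 1) := by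
  rw [mem_degreeLT, degree_lt_succ_iff_natDegree_le] at hp ⊢
  exact (opPoly_degree ha hb hab hp).1

/-- The stability estimate: it follows from testing the scheme with the weighted image of the
discrete solution under the operator. -/
theorem norm_toLp_opPoly_le {μ : ℝ} (hμ : |μ| ≤ pseudoEigenvalue (a + b) a 0 / 2) {f : ℝ → ℝ}
    (hf : MemLp f 2 (weightedMeasure b a)) {p : ℝ[X]}
    (hA : MemLp (fun x => (opPoly a b p).eval x) 2 (weightedMeasure b a))
    (h : schemeForm ha hb hab μ p (opPoly a b p) =
      ∫ x, f x * (opPoly a b p).eval x ∂weightedMeasure b a) :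
    ‖hA.toLp _‖ ≤ 2 * ‖hf.toLp f‖ := by
  have hw := continuous_jacobiWeight ha.1.le hb.1.le
  have hU : MemLp (fun x => jacobiWeight a b x * p.eval x) 2 (weightedMeasure b a) :=
    memLp_two_of_continuous (by linarith [hb.1]) (by linarith [ha.1]) (by fun_prop)
  have hl := pseudoEigenvalue_zero_pos ha hb hab
  rw [schemeForm_apply, ← norm_toLp_sq_eq_integral hA, ← inner_toLp_eq_integral hU hA,
    ← inner_toLp_eq_integral hf hA] at h
  have h1 : (pseudoEigenvalue (a + b) a 0 * ‖hU.toLp _‖) ^ 2 ≤ ‖hA.toLp _‖ ^ 2 := by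
    rw [mul_pow, norm_toLp_sq_eq_integral hA, norm_toLp_sq_eq_integral hU]
    exact (mul_le_mul_of_nonneg_left (integral_jacobiWeight_mul_sq_le ha.1 hb.1 p)
      (sq_nonneg _)).trans (sq_pseudoEigenvalue_mul_le ha hb hab p)
  have h2 := abs_le_of_sq_le_sq' h1 (norm_nonneg _)
  have h3 := real_inner_le_norm (hf.toLp f) (hA.toLp _)
  have h4 := abs_real_inner_le_norm (hU.toLp _) (hA.toLp _)
  have h5 : -(μ * inner ℝ (hU.toLp _) (hA.toLp _)) ≤ |μ| * (‖hU.toLp _‖ * ‖hA.toLp _‖) := by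
    refine (neg_le_abs _).trans ?_
    rw [abs_mul]
    exact mul_le_mul_of_nonneg_left h4 (abs_nonneg _)
  -- The smallness of `μ` leaves half of `‖Lu‖` after absorption; this is the source of the constant
  -- `2`.
  have h6 : |μ| * ‖hU.toLp _‖ ≤ ‖hA.toLp _‖ / 2 := by
    have := mul_le_mul_of_nonneg_right hμ (norm_nonneg (hU.toLp _))
    linarith [h2.2]
  rcases (norm_nonneg (hA.toLp _)).eq_or_lt with h0 | h0
  · rw [← h0]; positivity
  · have h7 := mul_le_mul_of_nonneg_right h6 h0.le
    have h8 : ‖hA.toLp _‖ * ‖hA.toLp _‖ ≤ (2 * ‖hf.toLp f‖) * ‖hA.toLp _‖ := by nlinarith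
    exact le_of_mul_le_mul_right h8 h0

/-- Stability with zero load kills `opPoly a b p`, and the lower bound by `λ_0 > 0` then kills `p`.
-/
theorem eq_zero_of_schemeForm_eq_zero {μ : ℝ} (hμ : |μ| ≤ pseudoEigenvalue (a + b) a 0 / 2) {N : ℕ}
    {p : ℝ[X]} (hp : p ∈ degreeLT ℝ (N + 1))
    (h : ∀ q ∈ degreeLT ℝ (N + 1), schemeForm ha hb hab μ p q = 0) : p = 0 := by
  have hA : MemLp (fun x => (opPoly a b p).eval x) 2 (weightedMeasure b a) :=
    memLp_two_of_continuous (by linarith [hb.1]) (by linarith [ha.1]) (by fun_prop)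
  have h1 := norm_toLp_opPoly_le ha hb hab hμ (MemLp.zero (μ := weightedMeasure b a)) hA (by
    rw [h _ (opPoly_mem_degreeLT ha hb hab hp)]; simp)
  rw [MemLp.toLp_zero, norm_zero, mul_zero] at h1
  have h2 := norm_toLp_sq_eq_integral hA
  rw [le_antisymm h1 (norm_nonneg _)] at h2
  have h3 := sq_pseudoEigenvalue_mul_le ha hb hab p
  rw [← h2, zero_pow two_ne_zero] at h3
  have ha' : -1 < a := by linarith [ha.1]
  have hb' : -1 < b := by linarith [hb.1]
  have h4 : jacobiForm ha' hb' p p ≤ 0 :=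
    nonpos_of_mul_nonpos_right h3 (pow_pos (pseudoEigenvalue_zero_pos ha hb hab) 2)
  exact eq_zero_of_jacobiForm_self ha' hb' (le_antisymm h4 (jacobiForm_self_nonneg ha' hb' p))

end

end FracPG

open FracPG Polynomial in
theorem theorem5p1 (α θ : ℝ) (hα : α ∈ Set.Ioo (1 : ℝ) 2) (hθ : θ ∈ Set.Icc (0 : ℝ) 1) :
    ∃ C : ℝ≥0, ∀ (σ μ : ℝ) (N : ℕ) (f : ℝ → ℝ),
      FracPG.IsExponent α θ σ →
      |μ| ≤ FracPG.pseudoEigenvalue α σ 0 / 2 →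
      MeasureTheory.MemLp f 2 (FracPG.weightedMeasure (α - σ) σ) →
      ∃ u : ℝ → ℝ,
        FracPG.IsPGSolution α θ σ μ N f u ∧
        (∀ w : ℝ → ℝ, FracPG.IsPGSolution α θ σ μ N f w → w = u) ∧
        FracPG.TwiceDiffOnI (FracPG.leftInt α u) ∧
        FracPG.TwiceDiffOnI (FracPG.rightInt α u) ∧
        MeasureTheory.MemLp (FracPG.fracOp α θ u) 2 (FracPG.weightedMeasure (α - σ) σ) ∧
        MeasureTheory.eLpNorm (FracPG.fracOp α θ u) 2 (FracPG.weightedMeasure (α - σ) σ) ≤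
          C * MeasureTheory.eLpNorm f 2 (FracPG.weightedMeasure (α - σ) σ) := by
  refine ⟨2, fun a μ N f hexp hμ hf => ?_⟩
  obtain ⟨b, rfl⟩ : ∃ b, α = a + b := ⟨α - a, by ring⟩
  obtain ⟨ha, hb, hθ'⟩ := hexp
  rw [add_sub_cancel_left] at hb hθ' hf ⊢
  have hb1 : -1 < b := by linarith [hb.1]
  have ha1 : -1 < a := by linarith [ha.1]
  have : FiniteDimensional ℝ (degreeLT ℝ (N + 1)) :=
    Module.Finite.equiv (degreeLTEquiv ℝ (N + 1)).symm
  -- Existence from uniqueness: trial and test spaces are both parametrized by `degreeLT ℝ (N + 1)`,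
  -- the polynomials of degree at most `N`.
  obtain ⟨p, hp, hsol⟩ := exists_forall_mem_eq (schemeForm ha hb hα μ) (degreeLT ℝ (N + 1))
    (fun p hp h => eq_zero_of_schemeForm_eq_zero ha hb hα hμ hp h) (loadFunctional hb1 ha1 hf)
  have hA : MemLp (fun x => (opPoly a b p).eval x) 2 (weightedMeasure b a) :=
    memLp_two_of_continuous hb1 ha1 (by fun_prop)
  have hAe : fracOp (a + b) θ (weightedEval a b p) =ᵐ[weightedMeasure b a]
      fun x => (opPoly a b p).eval x := by
    filter_upwards [ae_weightedMeasure_mem b a] with x hx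
      using fracOp_weightedEval ha hb hα hθ' p hx
  refine ⟨weightedEval a b p, (isPGSolution_weightedEval_iff ha hb hα hθ' hp).2 hsol, ?_,
    twiceDiffOnI_leftInt_weightedEval hb.1 hα.2 p, twiceDiffOnI_rightInt_weightedEval ha.1 hα.2 p,
    hA.ae_eq hAe.symm, ?_⟩
  · intro w hw
    obtain ⟨q, hq, rfl⟩ := mem_weightedPoly_iff.1 (by simpa using hw.1)
    have h1 := (isPGSolution_weightedEval_iff ha hb hα hθ' hq).1 hw
    have h2 := eq_zero_of_schemeForm_eq_zero ha hb hα hμ (Submodule.sub_mem _ hq hp) fun r hr => by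
      rw [map_sub, LinearMap.sub_apply, h1 r hr, hsol r hr]
      exact sub_self _
    rw [sub_eq_zero.1 h2]
  · rw [eLpNorm_congr_ae hAe]
    have h := norm_toLp_opPoly_le ha hb hα hμ hf hA (hsol _ (opPoly_mem_degreeLT ha hb hα hp))
    rw [Lp.norm_toLp, Lp.norm_toLp] at h
    rw [← ENNReal.toReal_le_toReal hA.eLpNorm_ne_top (ENNReal.mul_ne_top (by simp)
      hf.eLpNorm_ne_top), ENNReal.toReal_mul]
    simpa using h
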